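/- Let $n\ge 3$ be an integer and let $m>0$ be real. Write $|D|=\sqrt{-\Delta}$ on $\mathbb R^n$; that is, with $\widehat\varphi(\xi)=\int_{\mathbb R^n} e^{-ix\cdot\xi}\varphi(x)\,dx$ (extended to tempered distributions), $|D|^{m/2-1}e^{it|D|^m}\varphi$ is, for $\varphi\in L^2(\mathbb R^n)$ and $t\in\mathbb R$, the tempered distribution whose Fourier transform is $|\xi|^{m/2-1}e^{it|\xi|^m}\widehat\varphi(\xi)$. Then for every $\varphi\in L^2(\mathbb R^n)$ this distribution is, for almost every $t$, a function of $x$, jointly measurable in $(t,x)\in\mathbb R\times\mathbb R^n$ (after modification on a null set), and $$\bigl\||x|^{-1}|D|^{m/2-1}e^{it|D|^m}\varphi(x)\bigr\|_{L^2(\mathbb R_t\times\mathbb R^n_x)}\le\sqrt{\frac{2\pi}{m(n-2)}}\;\|\varphi\|_{L^2(\mathbb R^n_x)} .$$ The constant is sharp: for every $C<\sqrt{2\pi/(m(n-2))}$ there is $\varphi\in L^2(\mathbb R^n)$ for which the left-hand side is larger than $C\|\varphi\|_{L^2(\mathbb R^n)}$. -/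

import Mathlib

open MeasureTheory
open scoped FourierTransform SchwartzMap ENNReal

noncomputable section

/-- `IsFourierMultiplierImage σ φ u`: for `φ ∈ L²(ℝⁿ)`, the tempered distribution `σ(D) φ`, where
`D = -i∇`, is given by the function `u`. That is, `u` defines a tempered distribution, and its
Fourier transform is `σ` times the Fourier transform of `φ`, tested against Schwartz functions `ψ`.
Mathlib's Fourier transform has the kernel `exp (-2πi ⟨x, ξ⟩)`, so that the operator `σ(D)` acts at
the point `ξ` as multiplication by `σ (2πξ)`. -/
def IsFourierMultiplierImage {n : ℕ} (σ : EuclideanSpace ℝ (Fin n) → ℂ)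
    (φ : Lp ℂ 2 (volume : Measure (EuclideanSpace ℝ (Fin n))))
    (u : EuclideanSpace ℝ (Fin n) → ℂ) : Prop :=
  ∀ ψ : 𝓢(EuclideanSpace ℝ (Fin n), ℂ),
    Integrable (fun x => u x * (𝓕 ψ) x) volume ∧
    Integrable (fun ξ => σ ((2 * Real.pi) • ξ) * (𝓕 φ) ξ * ψ ξ) volume ∧
    ∫ x, u x * (𝓕 ψ) x = ∫ ξ, σ ((2 * Real.pi) • ξ) * (𝓕 φ) ξ * ψ ξ

/-- The symbol `|ξ| ^ (m / 2 - 1) * exp (i t |ξ| ^ m)` of `|D|^{m/2-1} e^{it|D|^m}`. -/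
def smoothingSymbol {n : ℕ} (m t : ℝ) (ξ : EuclideanSpace ℝ (Fin n)) : ℂ :=
  ((‖ξ‖ ^ (m / 2 - 1) : ℝ) : ℂ) * Complex.exp (Complex.I * ((t * ‖ξ‖ ^ m : ℝ) : ℂ))

/-- The measurable function `U` on `ℝ × ℝⁿ` is the space-time function
`(t, x) ↦ (|D|^{m/2-1} e^{it|D|^m} φ)(x)`: for almost every time `t`, the tempered distribution
`|D|^{m/2-1} e^{it|D|^m} φ` is the function `U (t, ·)`. -/
structure IsSmoothedEvolution {n : ℕ} (m : ℝ)
    (φ : Lp ℂ 2 (volume : Measure (EuclideanSpace ℝ (Fin n))))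
    (U : ℝ × EuclideanSpace ℝ (Fin n) → ℂ) : Prop where
  aestronglyMeasurable : AEStronglyMeasurable U volume
  isImage : ∀ᵐ t : ℝ, IsFourierMultiplierImage (smoothingSymbol m t) φ (fun x => U (t, x))

/-- The norm of `|x|⁻¹ U(t, x)` in `L²(ℝ × ℝⁿ)`, with values in `[0, ∞]`. -/
def weightedSpaceTimeNorm {n : ℕ} (U : ℝ × EuclideanSpace ℝ (Fin n) → ℂ) : ℝ≥0∞ :=
  eLpNorm (fun p : ℝ × EuclideanSpace ℝ (Fin n) => ((‖p.2‖⁻¹ : ℝ) : ℂ) * U p) 2 volume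

end

/-!
For a datum whose Fourier transform `f` is bounded and supported in an annulus (`IsAnnular`), the
evolution is an absolutely convergent Fourier integral (`annularEvolution`). In polar coordinates it
becomes, for fixed `x`, an oscillatory integral in `t` over the radial frequency `r`, whose
amplitude at `r` is the Fourier extension `sphereExt r` of the restriction of `f` to the sphere of
radius `r`. After the substitution `s = r ^ m`, Plancherel's theorem in `t`
(`lintegral_enorm_integral_power_phase_sq`) removes the oscillation. The factor `|D| ^ (m / 2 - 1)`
is exactly the one for which `m` survives only as the factor `1 / m`. Different radii decouple, so
what remains is the sharp bound of `‖|x|⁻¹ sphereExt r g‖` by `‖g‖` in `L²`, for each single `r`.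

The weight `|x|⁻²` is a superposition of Gaussians (`lintegral_gaussian_eq_inv_sq`). For a Gaussian
weight the energy of `sphereExt r g` is a quadratic form in `g` with a positive symmetric Gaussian
kernel (`integral_gaussian_mul_sphereExt_sq`), and the superposition of these kernels is a multiple
of the Newton kernel `‖ω - ω'‖ ^ (2 - n)` (`lintegral_sphereKernel`). Schur's test with the weight
`1` (`lintegral_mul_mul_kernel_le`) bounds the form by the integral of `|g ω|² ∫ ‖ω - ω'‖ ^ (2 - n)
dω'` in `ω`. By Newton's theorem (`lintegral_sphere_newton`) the inner integral is the area of the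
sphere, for every `ω`, whence the value of the constant. As it does not depend on `ω`, nothing is
lost, and Schur's test is an equality for constant `g`. Hence radial data attain the bound
(`weightedSpaceTimeNorm_annularEvolution_radial`).

For general data, annular data are dense in `L²`, and the bound makes `|x|⁻¹` times the evolutions
a Cauchy sequence in `L²` of space-time. A subsequence converges on almost every time slice, which
identifies the limit with the distribution `|D| ^ (m / 2 - 1) e ^ (i t |D| ^ m) φ`
(`exists_isSmoothedEvolution_le`). A function is determined almost everywhere by its distribution,
so every representative of the evolution satisfies the same bound (`IsSmoothedEvolution.ae_eq`).
-/

/-! ### The Fourier transform on tempered functions and Plancherel's theorem on `L¹ ∩ L²` -/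

theorem eLpNorm_two_sq {α : Type*} [MeasurableSpace α] (μ : Measure α) (f : α → ℂ) :
    eLpNorm f 2 μ ^ 2 = ∫⁻ x, ‖f x‖ₑ ^ 2 ∂μ := by
  have := eLpNorm_nnreal_pow_eq_lintegral (f := f) (μ := μ) (p := 2) two_ne_zero
  simpa using this

section FourierUniqueness

variable {V : Type*} [NormedAddCommGroup V] [InnerProductSpace ℝ V] [FiniteDimensional ℝ V]
  [MeasurableSpace V] [BorelSpace V]

/-- Testing against Schwartz functions that equal `1` on a ball gives local integrability. -/
theorem locallyIntegrable_of_integrable_mul_fourier {u : V → ℂ}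
    (hu : ∀ ψ : 𝓢(V, ℂ), Integrable (fun x => u x * (𝓕 ψ) x) volume) :
    LocallyIntegrable u volume := by
  intro x
  let b : ContDiffBump x := ⟨1, 2, by norm_num, by norm_num⟩
  have hc : HasCompactSupport (fun y => ((b y : ℝ) : ℂ)) :=
    b.hasCompactSupport.comp_left (g := fun r : ℝ => (r : ℂ)) (by simp)
  have hd : ContDiff ℝ ((⊤ : ℕ∞) : WithTop ℕ∞) (fun y => ((b y : ℝ) : ℂ)) :=
    Complex.ofRealCLM.contDiff.comp b.contDiff
  have h := hu (𝓕⁻ (hc.toSchwartzMap hd))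
  rw [FourierTransform.fourier_fourierInv_eq] at h
  refine ⟨Metric.ball x 1, Metric.ball_mem_nhds x one_pos, ?_⟩
  refine (h.integrableOn (s := Metric.ball x 1)).congr_fun (fun y hy => ?_) measurableSet_ball
  have : b y = 1 := b.one_of_mem_closedBall (Metric.ball_subset_closedBall hy)
  simp [this]

/-- A function is determined almost everywhere by the tempered distribution it defines. -/
theorem ae_eq_of_integral_mul_fourier_eq {u v : V → ℂ}
    (hu : ∀ ψ : 𝓢(V, ℂ), Integrable (fun x => u x * (𝓕 ψ) x) volume)
    (hv : ∀ ψ : 𝓢(V, ℂ), Integrable (fun x => v x * (𝓕 ψ) x) volume)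
    (h : ∀ ψ : 𝓢(V, ℂ), ∫ x, u x * (𝓕 ψ) x = ∫ x, v x * (𝓕 ψ) x) :
    u =ᵐ[volume] v := by
  refine ae_eq_of_integral_contDiff_smul_eq (locallyIntegrable_of_integrable_mul_fourier hu)
    (locallyIntegrable_of_integrable_mul_fourier hv) fun g hg hgc => ?_
  have hc : HasCompactSupport (fun y => ((g y : ℝ) : ℂ)) :=
    hgc.comp_left (g := fun r : ℝ => (r : ℂ)) (by simp)
  have hd : ContDiff ℝ ((⊤ : ℕ∞) : WithTop ℕ∞) (fun y => ((g y : ℝ) : ℂ)) :=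
    Complex.ofRealCLM.contDiff.comp hg
  have := h (𝓕⁻ (hc.toSchwartzMap hd))
  rw [FourierTransform.fourier_fourierInv_eq] at this
  simpa [mul_comm] using this

theorem continuous_fourierInv {f : V → ℂ} (hf : Integrable f) : Continuous (𝓕⁻ f) := by
  have : 𝓕⁻ f = fun w => 𝓕 f (-w) := by
    ext w; exact Real.fourierInv_eq_fourier_neg f w
  rw [this]
  exact (VectorFourier.fourierIntegral_continuous Real.continuous_fourierChar
    (by exact continuous_inner) hf).comp continuous_neg

theorem norm_fourierInv_le {f : V → ℂ} (w : V) : ‖𝓕⁻ f w‖ ≤ ∫ x, ‖f x‖ := by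
  rw [Real.fourierInv_eq_fourier_neg]
  exact VectorFourier.norm_fourierIntegral_le_integral_norm _ _ _ _ _

theorem integrable_fourierInv_mul {f : V → ℂ} (hf : Integrable f) (ψ : 𝓢(V, ℂ)) :
    Integrable (fun x => 𝓕⁻ f x * ψ x) :=
  ψ.integrable.bdd_mul (continuous_fourierInv hf).aestronglyMeasurable
    (ae_of_all _ norm_fourierInv_le)

theorem integral_fourierInv_mul_eq {f : V → ℂ} (hf : Integrable f) (ψ : 𝓢(V, ℂ)) :
    ∫ x, 𝓕⁻ f x * ψ x = ∫ x, f x * (𝓕⁻ ψ) x := by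
  have h := VectorFourier.integral_fourierIntegral_smul_eq_flip (L := -innerₗ V) (μ := volume)
    (ν := volume) (f := f) (g := ψ) Real.continuous_fourierChar
    (by simp only [LinearMap.neg_apply, innerₗ_apply_apply]; fun_prop) hf ψ.integrable
  simp only [smul_eq_mul] at h
  have e₁ : ∀ x, 𝓕⁻ f x = VectorFourier.fourierIntegral Real.fourierChar volume (-innerₗ V) f x :=
    fun x => by simp [Real.fourierInv_eq, VectorFourier.fourierIntegral]
  have e₂ : ∀ x, (𝓕⁻ ψ) x =
      VectorFourier.fourierIntegral Real.fourierChar volume (-innerₗ V).flip ψ x := fun x => by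
    rw [SchwartzMap.fourierInv_coe]
    simp [Real.fourierInv_eq, VectorFourier.fourierIntegral, real_inner_comm]
  simp_rw [e₁, e₂]
  exact h

/-- The integral formula for the inverse Fourier transform agrees with the `L²` one on
`L¹ ∩ L²`. -/
theorem fourierInv_toLp_ae_eq {f : V → ℂ} (hf : Integrable f) (hf2 : MemLp f 2) :
    (𝓕⁻ (hf2.toLp f) : Lp ℂ 2 (volume : Measure V)) =ᵐ[volume] 𝓕⁻ f := by
  refine ae_eq_of_integral_mul_fourier_eq (fun ψ => ?_)
    (fun ψ => integrable_fourierInv_mul hf _) fun ψ => ?_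
  · exact (Lp.memLp _).integrable_mul ((𝓕 ψ).memLp 2)
  · have h := congrArg (fun T => T (𝓕 ψ))
      (Lp.fourierInv_toTemperedDistribution_eq (hf2.toLp f))
    simp only [TemperedDistribution.fourierInv_apply, Lp.toTemperedDistribution_apply,
      smul_eq_mul] at h
    rw [integral_fourierInv_mul_eq hf]
    simp_rw [mul_comm _ ((𝓕 ψ) _)]
    rw [← h]
    refine integral_congr_ae ?_
    filter_upwards [hf2.coeFn_toLp] with x hx
    rw [hx, mul_comm]

/-- Plancherel's theorem on `L¹ ∩ L²`. -/
theorem lintegral_enorm_fourierInv_sq {f : V → ℂ} (hf : Integrable f) (hf2 : MemLp f 2) :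
    ∫⁻ x, ‖𝓕⁻ f x‖ₑ ^ 2 = ∫⁻ x, ‖f x‖ₑ ^ 2 := by
  have key : eLpNorm (𝓕⁻ f) 2 volume = eLpNorm f 2 volume := by
    rw [← eLpNorm_congr_ae (fourierInv_toLp_ae_eq hf hf2), ← eLpNorm_congr_ae hf2.coeFn_toLp,
      ← Lp.enorm_def, ← Lp.enorm_def]
    have : ‖𝓕⁻ (hf2.toLp f)‖ = ‖hf2.toLp f‖ := by
      rw [← Lp.norm_fourier_eq, FourierTransform.fourier_fourierInv_eq]
    rw [← ofReal_norm, ← ofReal_norm, this]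
  rw [← eLpNorm_two_sq, ← eLpNorm_two_sq, key]

end FourierUniqueness

/-! ### Polar coordinates -/

section Polar

variable {E : Type*} [NormedAddCommGroup E] [NormedSpace ℝ E] [Nontrivial E]
  [FiniteDimensional ℝ E] [MeasurableSpace E] [BorelSpace E] (μ : Measure E) [μ.IsAddHaarMeasure]

open Module

/-- Polar coordinates for nonnegative functions. -/
theorem lintegral_polar {F : E → ℝ≥0∞} (hF : Measurable F) :
    ∫⁻ x, F x ∂μ = ∫⁻ r in Set.Ioi (0 : ℝ), ENNReal.ofReal (r ^ (finrank ℝ E - 1)) *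
      ∫⁻ ω : Metric.sphere (0 : E) 1, F (r • (ω : E)) ∂μ.toSphere := by
  have hm : Measurable fun p : Metric.sphere (0 : E) 1 × Set.Ioi (0 : ℝ) =>
      F ((p.2 : ℝ) • (p.1 : E)) := by
    refine hF.comp (Continuous.measurable ?_)
    fun_prop
  calc ∫⁻ x, F x ∂μ = ∫⁻ x : ({(0)}ᶜ : Set E), F x ∂(μ.comap (↑)) := by
        rw [lintegral_subtype_comap (measurableSet_singleton _).compl,
          restrict_compl_singleton]
    _ = ∫⁻ p, F ((p.2 : ℝ) • (p.1 : E))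
          ∂μ.toSphere.prod (.volumeIoiPow (finrank ℝ E - 1)) := by
        rw [← μ.measurePreserving_homeomorphUnitSphereProd.lintegral_comp hm]
        refine lintegral_congr fun x => ?_
        have : ‖(x : E)‖ ≠ 0 := norm_ne_zero_iff.2 x.2
        simp [smul_smul, this]
    _ = ∫⁻ r, ∫⁻ ω, F ((r : ℝ) • (ω : E)) ∂μ.toSphere ∂(Measure.volumeIoiPow (finrank ℝ E - 1)) :=
        lintegral_prod_symm' _ hm
    _ = _ := by
        rw [Measure.volumeIoiPow, lintegral_withDensity_eq_lintegral_mul _ (by fun_prop)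
          hm.lintegral_prod_left',
          ← lintegral_subtype_comap measurableSet_Ioi]
        rfl

/-- Polar coordinates for integrable functions. -/
theorem integral_polar {F : E → ℂ} (hF : Integrable F μ) :
    ∫ x, F x ∂μ = ∫ r in Set.Ioi (0 : ℝ), (r ^ (finrank ℝ E - 1) : ℝ) •
      ∫ ω : Metric.sphere (0 : E) 1, F (r • (ω : E)) ∂μ.toSphere := by
  have h0 : ∀ x : ({(0)}ᶜ : Set E),
      ((homeomorphUnitSphereProd E x).2 : ℝ) • ((homeomorphUnitSphereProd E x).1 : E) = x := by
    intro x
    have : ‖(x : E)‖ ≠ 0 := norm_ne_zero_iff.2 x.2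
    simp [smul_smul, this]
  have hemb := (homeomorphUnitSphereProd E).measurableEmbedding
  have hint : Integrable (fun p : Metric.sphere (0 : E) 1 × Set.Ioi (0 : ℝ) =>
      F ((p.2 : ℝ) • (p.1 : E))) (μ.toSphere.prod (.volumeIoiPow (finrank ℝ E - 1))) := by
    rw [← μ.measurePreserving_homeomorphUnitSphereProd.integrable_comp_emb hemb]
    simp only [Function.comp_def, h0]
    refine (integrableOn_iff_comap_subtypeVal (measurableSet_singleton _).compl).1 ?_
    exact hF.integrableOn
  calc ∫ x, F x ∂μ = ∫ x : ({(0)}ᶜ : Set E), F x ∂(μ.comap (↑)) := by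
        rw [integral_subtype_comap (measurableSet_singleton _).compl,
          restrict_compl_singleton]
    _ = ∫ p, F ((p.2 : ℝ) • (p.1 : E))
          ∂μ.toSphere.prod (.volumeIoiPow (finrank ℝ E - 1)) := by
        rw [← μ.measurePreserving_homeomorphUnitSphereProd.integral_comp hemb]
        simp only [h0]
    _ = ∫ r, ∫ ω, F ((r : ℝ) • (ω : E)) ∂μ.toSphere ∂(Measure.volumeIoiPow (finrank ℝ E - 1)) :=
        integral_prod_symm _ hint
    _ = _ := by
        simp only [Measure.volumeIoiPow, ENNReal.ofReal]
        rw [integral_withDensity_eq_integral_smul,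
          integral_subtype_comap measurableSet_Ioi fun a ↦ Real.toNNReal (a ^ (finrank ℝ E - 1)) •
            ∫ ω : Metric.sphere (0 : E) 1, F (a • (ω : E)) ∂μ.toSphere,
          setIntegral_congr_fun measurableSet_Ioi fun x hx ↦ ?_]
        · rw [NNReal.smul_def, Real.coe_toNNReal _ (pow_nonneg hx.out.le _)]
        · exact (measurable_subtype_coe.pow_const _).real_toNNReal

end Polar

/-! ### Newton's theorem for the unit sphere -/

section Newton

open Real Set

/-- Spherical coordinates with a distinguished axis: `x 0 = r cos θ` and `‖x‖ = r`. The power of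
`sin θ` accounts for the sphere of directions orthogonal to the axis. -/
theorem lintegral_axial {k : ℕ} (hk : 1 ≤ k) {G : ℝ × ℝ → ℝ≥0∞} (hG : Measurable G) :
    ∫⁻ x : EuclideanSpace ℝ (Fin (k + 1)), G (x 0, ‖x‖) =
      (volume : Measure (EuclideanSpace ℝ (Fin k))).toSphere univ *
        ∫⁻ p in Ioi (0 : ℝ) ×ˢ Ioo 0 π, ENNReal.ofReal (p.1 ^ k * sin p.2 ^ (k - 1)) *
          G (p.1 * cos p.2, p.1) := by
  have : Nonempty (Fin k) := ⟨⟨0, hk⟩⟩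
  have hfin : Module.finrank ℝ (EuclideanSpace ℝ (Fin k)) = k := by simp
  set c := (volume : Measure (EuclideanSpace ℝ (Fin k))).toSphere univ with hc
  calc ∫⁻ x : EuclideanSpace ℝ (Fin (k + 1)), G (x 0, ‖x‖)
      = ∫⁻ x : Fin (k + 1) → ℝ, G (x 0, √(x 0 ^ 2 + ∑ i : Fin k, x i.succ ^ 2)) := by
        rw [← (EuclideanSpace.volume_preserving_symm_measurableEquiv_toLp
          (Fin (k + 1))).lintegral_comp (by fun_prop)]
        refine lintegral_congr fun x => ?_
        simp [EuclideanSpace.norm_eq, Fin.sum_univ_succ]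
    _ = ∫⁻ p : ℝ × (Fin k → ℝ), G (p.1, √(p.1 ^ 2 + ∑ i : Fin k, p.2 i ^ 2)) := by
        rw [← (volume_preserving_piFinSuccAbove (fun _ : Fin (k + 1) => ℝ) 0).lintegral_comp
          (by fun_prop)]
        refine lintegral_congr fun x => ?_
        simp [MeasurableEquiv.piFinSuccAbove, Fin.insertNthEquiv, Fin.tail]
    _ = ∫⁻ a : ℝ, ∫⁻ y : Fin k → ℝ, G (a, √(a ^ 2 + ∑ i : Fin k, y i ^ 2)) := by
        rw [Measure.volume_eq_prod, lintegral_prod _ (by fun_prop)]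
    _ = ∫⁻ a : ℝ, ∫⁻ y : EuclideanSpace ℝ (Fin k), G (a, √(a ^ 2 + ‖y‖ ^ 2)) := by
        refine lintegral_congr fun a => ?_
        rw [← (EuclideanSpace.volume_preserving_symm_measurableEquiv_toLp
          (Fin k)).lintegral_comp (by fun_prop)]
        refine lintegral_congr fun x => ?_
        simp [EuclideanSpace.norm_sq_eq]
    _ = ∫⁻ a : ℝ, c * ∫⁻ ρ in Ioi (0 : ℝ), ENNReal.ofReal (ρ ^ (k - 1)) *
          G (a, √(a ^ 2 + ρ ^ 2)) := by
        refine lintegral_congr fun a => ?_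
        rw [lintegral_polar _ (by fun_prop), hfin, ← lintegral_const_mul _ (by fun_prop)]
        refine setLIntegral_congr_fun measurableSet_Ioi fun r (hr : 0 < r) => ?_
        simp [norm_smul, abs_of_pos hr, hc]
        ring
    _ = c * ∫⁻ a : ℝ, ∫⁻ ρ : ℝ, (Ioi (0 : ℝ)).indicator (fun ρ => ENNReal.ofReal (ρ ^ (k - 1)) *
          G (a, √(a ^ 2 + ρ ^ 2))) ρ := by
        rw [lintegral_const_mul]
        · simp_rw [lintegral_indicator measurableSet_Ioi]
        · refine Measurable.lintegral_prod_right'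
            (f := fun p : ℝ × ℝ => ENNReal.ofReal (p.2 ^ (k - 1)) * G (p.1, √(p.1 ^ 2 + p.2 ^ 2))) ?_
          fun_prop
    _ = c * ∫⁻ p : ℝ × ℝ, (univ ×ˢ Ioi (0 : ℝ)).indicator (fun p =>
          ENNReal.ofReal (p.2 ^ (k - 1)) * G (p.1, √(p.1 ^ 2 + p.2 ^ 2))) p := by
        rw [Measure.volume_eq_prod, lintegral_prod _
          ((by fun_prop : Measurable _).indicator (by measurability)).aemeasurable]
        simp [indicator]
    _ = _ := by
        rw [← lintegral_comp_polarCoord_symm, polarCoord_target]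
        congr 1
        rw [← lintegral_indicator (by measurability), ← lintegral_indicator (by measurability)]
        refine lintegral_congr fun ⟨r, θ⟩ => ?_
        by_cases hr : 0 < r
        · by_cases h1 : 0 < θ ∧ θ < π
          · have hs := sin_pos_of_pos_of_lt_pi h1.1 h1.2
            have h2 : -π < θ := by linarith [pi_pos]
            have h3 : √((r * cos θ) ^ 2 + (r * sin θ) ^ 2) = r := by
              rw [mul_pow, mul_pow, ← mul_add, cos_sq_add_sin_sq, mul_one, sqrt_sq hr.le]
            simp only [mem_prod, mem_Ioi, hr, mem_Ioo, h2, h1.1, h1.2, and_self, indicator_of_mem,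
              polarCoord_symm_apply, mem_univ, mul_pos hr hs, h3, smul_eq_mul]
            rw [← mul_assoc, ← ENNReal.ofReal_mul hr.le]
            congr 2
            obtain ⟨j, rfl⟩ := Nat.exists_eq_add_of_le' hk
            simp only [Nat.add_sub_cancel]
            ring
          · have h4 : (r, θ) ∉ Ioi (0 : ℝ) ×ˢ Ioo 0 π := by simp [hr]; grind
            rw [indicator_of_notMem h4]
            by_cases h5 : -π < θ ∧ θ < π
            · have : sin θ ≤ 0 := sin_nonpos_of_nonpos_of_neg_pi_le (by grind) h5.1.le
              have : ¬ 0 < r * sin θ := not_lt.2 (mul_nonpos_of_nonneg_of_nonpos hr.le this)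
              simp [this]
            · rw [indicator_of_notMem]; simp [hr]; grind
        · simp [hr]

/-- Dividing `sin θ ^ j` by `(2 sin (θ / 2)) ^ j`, the `j`-th power of the distance of two points of
the unit circle at angle `θ`, leaves `cos (θ / 2) ^ j`. The integral over `[0, π]` is unchanged. -/
theorem integral_cos_half_pow (j : ℕ) :
    ∫ θ in (0 : ℝ)..π, cos (θ / 2) ^ j = ∫ θ in (0 : ℝ)..π, sin θ ^ j := by
  rw [intervalIntegral.integral_comp_div (fun x => cos x ^ j) two_ne_zero, zero_div,
    EulerSine.integral_cos_pow_eq]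
  simp

theorem lintegral_Ioo_pi_eq_ofReal {f : ℝ → ℝ} (hf : Continuous f)
    (h0 : ∀ θ ∈ Ioo 0 π, 0 ≤ f θ) :
    ∫⁻ θ in Ioo 0 π, ENNReal.ofReal (f θ) = ENNReal.ofReal (∫ θ in (0 : ℝ)..π, f θ) := by
  rw [intervalIntegral.integral_of_le pi_pos.le, integral_Ioc_eq_integral_Ioo,
    ofReal_integral_eq_lintegral_ofReal]
  · exact (hf.integrableOn_Icc (a := 0) (b := π)).mono_set Ioo_subset_Icc_self
  · filter_upwards [ae_restrict_mem measurableSet_Ioo] with θ hθ using h0 θ hθ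

/-- The kernel `‖ω - e‖ ^ (-j)` for unit vectors `ω` and `e`, as a function of `(⟨x, e⟩, ‖x‖)` where
`ω = x / ‖x‖`. It is `∞` where `ω = e`. -/
noncomputable def axialKernel (j : ℕ) (p : ℝ × ℝ) : ℝ≥0∞ :=
  (ENNReal.ofReal (√(2 - 2 * (p.1 / p.2)) ^ j))⁻¹

theorem measurable_axialKernel (j : ℕ) : Measurable (axialKernel j) := by
  unfold axialKernel; fun_prop

/-- Newton's theorem for the unit sphere, integrated over all radii against a Gaussian, which turns
the surface integral into one over the whole space. -/
theorem lintegral_axialKernel_exp {k : ℕ} (hk : 1 ≤ k) :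
    ∫⁻ x : EuclideanSpace ℝ (Fin (k + 1)),
        axialKernel (k - 1) (x 0, ‖x‖) * ENNReal.ofReal (exp (-‖x‖ ^ 2)) =
      ∫⁻ x : EuclideanSpace ℝ (Fin (k + 1)), ENNReal.ofReal (exp (-‖x‖ ^ 2)) := by
  have hm := measurable_axialKernel (k - 1)
  rw [lintegral_axial hk (G := fun p => axialKernel (k - 1) p * ENNReal.ofReal (exp (-p.2 ^ 2)))
    (by fun_prop), lintegral_axial hk (G := fun p => ENNReal.ofReal (exp (-p.2 ^ 2)))
    (by fun_prop)]
  congr 1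
  rw [Measure.volume_eq_prod, ← Measure.prod_restrict, lintegral_prod _ (by fun_prop),
    lintegral_prod _ (by fun_prop)]
  refine setLIntegral_congr_fun measurableSet_Ioi fun r (hr : 0 < r) => ?_
  have e1 : ∀ θ ∈ Ioo 0 π, ENNReal.ofReal (r ^ k * sin θ ^ (k - 1)) *
      (axialKernel (k - 1) (r * cos θ, r) * ENNReal.ofReal (exp (-r ^ 2))) =
      ENNReal.ofReal (r ^ k * exp (-r ^ 2)) * ENNReal.ofReal (cos (θ / 2) ^ (k - 1)) := by
    intro θ hθ
    have hs : 0 < sin (θ / 2) := sin_pos_of_pos_of_lt_pi (by linarith [hθ.1])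
      (by linarith [hθ.1, hθ.2])
    have hc : 0 < cos (θ / 2) := cos_pos_of_mem_Ioo ⟨by linarith [hθ.1, pi_pos], by linarith [hθ.2]⟩
    have h1 : √(2 - 2 * (r * cos θ / r)) = 2 * sin (θ / 2) := by
      rw [mul_div_cancel_left₀ _ hr.ne', sqrt_eq_iff_eq_sq]
      · have := cos_sq' (θ / 2)
        have h2 : cos θ = 2 * cos (θ / 2) ^ 2 - 1 := by rw [← cos_two_mul]; congr 1; ring
        rw [h2, this]; ring
      · linarith [cos_le_one θ]
      · positivity
    have h2 : sin θ = 2 * sin (θ / 2) * cos (θ / 2) := by rw [← sin_two_mul]; congr 1; ring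
    rw [axialKernel, h1, h2, ← ENNReal.ofReal_inv_of_pos (by positivity),
      ← ENNReal.ofReal_mul (by positivity), ← ENNReal.ofReal_mul (by positivity),
      ← ENNReal.ofReal_mul (by positivity)]
    congr 1
    rw [mul_pow]
    field_simp
  have e2 : ∀ θ ∈ Ioo 0 π, ENNReal.ofReal (r ^ k * sin θ ^ (k - 1)) *
      ENNReal.ofReal (exp (-r ^ 2)) =
      ENNReal.ofReal (r ^ k * exp (-r ^ 2)) * ENNReal.ofReal (sin θ ^ (k - 1)) := by
    intro θ hθ
    have hs : 0 < sin θ := sin_pos_of_pos_of_lt_pi hθ.1 hθ.2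
    rw [← ENNReal.ofReal_mul (by positivity), ← ENNReal.ofReal_mul (by positivity)]
    congr 1; ring
  rw [setLIntegral_congr_fun measurableSet_Ioo e1, setLIntegral_congr_fun measurableSet_Ioo e2,
    lintegral_const_mul _ (by fun_prop), lintegral_const_mul _ (by fun_prop),
    lintegral_Ioo_pi_eq_ofReal (by fun_prop), lintegral_Ioo_pi_eq_ofReal (by fun_prop),
    integral_cos_half_pow]
  · intro θ hθ
    have := sin_pos_of_pos_of_lt_pi hθ.1 hθ.2
    positivity
  · intro θ hθ
    have : 0 < cos (θ / 2) := cos_pos_of_mem_Ioo ⟨by linarith [hθ.1, pi_pos], by linarith [hθ.2]⟩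
    positivity

/-- Newton's theorem on the sphere itself: the potential of the uniform unit sphere, with respect to
the kernel `|x| ^ (2 - n)`, equals at every point of the sphere its value at the centre. -/
theorem lintegral_sphere_newton {n : ℕ} (hn : 2 ≤ n)
    (e : Metric.sphere (0 : EuclideanSpace ℝ (Fin n)) 1) :
    ∫⁻ ω : Metric.sphere (0 : EuclideanSpace ℝ (Fin n)) 1,
        (ENNReal.ofReal (‖(ω : EuclideanSpace ℝ (Fin n)) - e‖ ^ (n - 2)))⁻¹
          ∂(volume : Measure (EuclideanSpace ℝ (Fin n))).toSphere =
      (volume : Measure (EuclideanSpace ℝ (Fin n))).toSphere univ := by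
  obtain ⟨k, rfl⟩ : ∃ k, n = k + 1 := ⟨n - 1, by omega⟩
  have hk : 1 ≤ k := by omega
  have hj : k + 1 - 2 = k - 1 := by omega
  rw [hj]
  have hm := measurable_axialKernel (k - 1)
  -- `I` is the common radial factor, to be cancelled at the end
  set I := ∫⁻ r in Ioi (0 : ℝ), ENNReal.ofReal (r ^ k) * ENNReal.ofReal (exp (-r ^ 2)) with hI
  have hfin : Module.finrank ℝ (EuclideanSpace ℝ (Fin (k + 1))) - 1 = k := by simp
  have p1 : ∫⁻ x : EuclideanSpace ℝ (Fin (k + 1)), ENNReal.ofReal (exp (-‖x‖ ^ 2)) =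
      I * (volume : Measure (EuclideanSpace ℝ (Fin (k + 1)))).toSphere univ := by
    rw [lintegral_polar _ (by fun_prop), hfin, hI, ← lintegral_mul_const _ (by fun_prop)]
    refine setLIntegral_congr_fun measurableSet_Ioi fun r (hr : 0 < r) => ?_
    simp [norm_smul, abs_of_pos hr, mul_assoc]
  have p2 : ∫⁻ x : EuclideanSpace ℝ (Fin (k + 1)),
        axialKernel (k - 1) (inner ℝ x (e : EuclideanSpace ℝ (Fin (k + 1))), ‖x‖) *
          ENNReal.ofReal (exp (-‖x‖ ^ 2)) =
      I * ∫⁻ ω : Metric.sphere (0 : EuclideanSpace ℝ (Fin (k + 1))) 1,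
        (ENNReal.ofReal (‖(ω : EuclideanSpace ℝ (Fin (k + 1))) - e‖ ^ (k - 1)))⁻¹
          ∂(volume : Measure (EuclideanSpace ℝ (Fin (k + 1)))).toSphere := by
    rw [lintegral_polar _ (by fun_prop), hfin, hI, ← lintegral_mul_const _ (by fun_prop)]
    refine setLIntegral_congr_fun measurableSet_Ioi fun r (hr : 0 < r) => ?_
    rw [mul_assoc]
    congr 1
    rw [← lintegral_const_mul _ (by fun_prop)]
    refine lintegral_congr fun ω => ?_
    have hω : ‖(ω : EuclideanSpace ℝ (Fin (k + 1)))‖ = 1 := by simp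
    have he : ‖(e : EuclideanSpace ℝ (Fin (k + 1)))‖ = 1 := by simp
    have h1 : √(2 - 2 * (r * inner ℝ (ω : EuclideanSpace ℝ (Fin (k + 1))) e / r)) =
        ‖(ω : EuclideanSpace ℝ (Fin (k + 1))) - e‖ := by
      rw [mul_div_cancel_left₀ _ hr.ne', ← sqrt_sq (norm_nonneg (_ - _)), norm_sub_sq_real, hω, he]
      congr 1; ring
    rw [norm_smul, hω, norm_eq_abs, abs_of_pos hr, mul_one, inner_smul_left, axialKernel]
    simp only [conj_trivial, h1]
    ring
  -- a reflection carries `e` to the first basis vector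
  let e₁ : EuclideanSpace ℝ (Fin (k + 1)) := EuclideanSpace.single 0 1
  have p3 : ∫⁻ x : EuclideanSpace ℝ (Fin (k + 1)),
        axialKernel (k - 1) (inner ℝ x (e : EuclideanSpace ℝ (Fin (k + 1))), ‖x‖) *
          ENNReal.ofReal (exp (-‖x‖ ^ 2)) =
      ∫⁻ x : EuclideanSpace ℝ (Fin (k + 1)),
        axialKernel (k - 1) (x 0, ‖x‖) * ENNReal.ofReal (exp (-‖x‖ ^ 2)) := by
    have hR := Submodule.reflection_sub (v := e₁) (w := (e : EuclideanSpace ℝ (Fin (k + 1))))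
      (by simp [e₁])
    set R := (Submodule.span ℝ {e₁ - (e : EuclideanSpace ℝ (Fin (k + 1)))})ᗮ.reflection
    rw [← R.measurePreserving.lintegral_comp (by fun_prop)]
    refine lintegral_congr fun x => ?_
    rw [← hR, R.inner_map_map, R.norm_map]
    simp [e₁, EuclideanSpace.inner_single_right]
  rw [p2, lintegral_axialKernel_exp hk, p1] at p3
  have hI' : I = ENNReal.ofReal (∫ r in Ioi (0 : ℝ), r ^ (k : ℝ) * exp (-1 * r ^ 2)) := by
    rw [ofReal_integral_eq_lintegral_ofReal
      (integrableOn_rpow_mul_exp_neg_mul_sq one_pos (by have := k.cast_nonneg (α := ℝ); linarith))]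
    · refine setLIntegral_congr_fun measurableSet_Ioi fun r (hr : 0 < r) => ?_
      rw [← ENNReal.ofReal_mul (by positivity)]
      simp
    · filter_upwards [ae_restrict_mem measurableSet_Ioi] with r (hr : 0 < r)
      positivity
  have hIfin : I ≠ ∞ := by rw [hI']; exact ENNReal.ofReal_ne_top
  have hI0 : I ≠ 0 := by
    intro h
    rw [hI, lintegral_eq_zero_iff (by fun_prop)] at h
    have h2 : ∀ᵐ r ∂(volume.restrict (Ioi (0 : ℝ))), False := by
      filter_upwards [h, ae_restrict_mem measurableSet_Ioi] with r h3 (hr : 0 < r)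
      simp at h3
      rcases h3 with h3 | h3
      · exact (pow_pos hr k).not_ge h3
      · exact (exp_pos _).not_ge h3
    rw [Filter.eventually_false_iff_eq_bot, ae_eq_bot, Measure.restrict_eq_zero] at h2
    simp at h2
  exact (ENNReal.mul_right_inj hI0 hIfin).1 p3

end Newton

/-! ### The Fourier extension operator of a sphere with Gaussian weights -/

section SphereExtension

open Real Set

variable {n : ℕ}

/-- The Fourier extension operator of the sphere of radius `r`: the inverse Fourier transform of
`g dσ`, where `g` is carried by the unit sphere, with frequencies rescaled by `r`. -/
noncomputable def sphereExt (r : ℝ) (g : Metric.sphere (0 : EuclideanSpace ℝ (Fin n)) 1 → ℂ)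
    (x : EuclideanSpace ℝ (Fin n)) : ℂ :=
  ∫ ω, Complex.exp (((2 * π * (r * inner ℝ (ω : EuclideanSpace ℝ (Fin n)) x) : ℝ) : ℂ) * Complex.I) *
    g ω ∂(volume : Measure (EuclideanSpace ℝ (Fin n))).toSphere

theorem norm_sphereExt_le {r M : ℝ} {g : Metric.sphere (0 : EuclideanSpace ℝ (Fin n)) 1 → ℂ}
    (hM : ∀ ω, ‖g ω‖ ≤ M) (x : EuclideanSpace ℝ (Fin n)) :
    ‖sphereExt r g x‖ ≤ M * (volume : Measure (EuclideanSpace ℝ (Fin n))).toSphere.real univ := by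
  refine norm_integral_le_of_norm_le_const (ae_of_all _ fun ω => ?_)
  rw [norm_mul, Complex.norm_exp_ofReal_mul_I, one_mul]
  exact hM ω

theorem measurable_sphereExt {r : ℝ} {g : Metric.sphere (0 : EuclideanSpace ℝ (Fin n)) 1 → ℂ}
    (hg : Measurable g) : Measurable (sphereExt r g) := by
  refine (StronglyMeasurable.integral_prod_right' (f := fun p : EuclideanSpace ℝ (Fin n) ×
    Metric.sphere (0 : EuclideanSpace ℝ (Fin n)) 1 => Complex.exp (((2 * π * (r *
      inner ℝ (p.2 : EuclideanSpace ℝ (Fin n)) p.1) : ℝ) : ℂ) * Complex.I) * g p.2) ?_).measurable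
  refine (Measurable.mul ?_ (hg.comp measurable_snd)).stronglyMeasurable
  refine Continuous.measurable ?_
  fun_prop

/-- The Fourier transform of a Gaussian of variance proportional to `v`. -/
theorem integral_gaussian_mul_cexp {v : ℝ} (hv : 0 < v) (w : EuclideanSpace ℝ (Fin n)) :
    ∫ x : EuclideanSpace ℝ (Fin n), ((exp (-(π / v) * ‖x‖ ^ 2) : ℝ) : ℂ) *
        Complex.exp (((2 * π * inner ℝ w x : ℝ) : ℂ) * Complex.I) =
      ((v ^ ((n : ℝ) / 2) * exp (-(π * v * ‖w‖ ^ 2)) : ℝ) : ℂ) := by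
  have hb : 0 < (((π / v : ℝ) : ℂ)).re := by rw [Complex.ofReal_re]; positivity
  have h := GaussianFourier.integral_cexp_neg_mul_sq_norm_add hb (2 * π * Complex.I) w
  have e : ∀ x : EuclideanSpace ℝ (Fin n), ((exp (-(π / v) * ‖x‖ ^ 2) : ℝ) : ℂ) *
        Complex.exp (((2 * π * inner ℝ w x : ℝ) : ℂ) * Complex.I) =
      Complex.exp (-((π / v : ℝ) : ℂ) * ‖x‖ ^ 2 + 2 * π * Complex.I * (inner ℝ w x : ℝ)) := by
    intro x
    rw [Complex.ofReal_exp, ← Complex.exp_add]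
    congr 1
    push_cast
    ring
  simp_rw [e]
  rw [h, Complex.ofReal_mul, Complex.ofReal_exp, Complex.ofReal_cpow hv.le]
  have hπ : (π : ℂ) ≠ 0 := by exact_mod_cast pi_ne_zero
  have hv' : (v : ℂ) ≠ 0 := by exact_mod_cast hv.ne'
  congr 2
  · push_cast
    field_simp
  · simp
  · push_cast
    rw [mul_pow, Complex.I_sq]
    field_simp
    ring

theorem integrable_gaussian {v : ℝ} (hv : 0 < v) :
    Integrable (fun x : EuclideanSpace ℝ (Fin n) => exp (-(π / v) * ‖x‖ ^ 2)) := by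
  refine Integrable.of_integral_ne_zero ?_
  rw [GaussianFourier.integral_rexp_neg_mul_sq_norm (by positivity)]
  have : 0 < π / (π / v) := by positivity
  exact (rpow_pos_of_pos this _).ne'

theorem integrable_gaussian_mul_sphereExt_sq {v r M : ℝ} (hv : 0 < v)
    {g : Metric.sphere (0 : EuclideanSpace ℝ (Fin n)) 1 → ℂ} (hg : Measurable g)
    (hM : ∀ ω, ‖g ω‖ ≤ M) :
    Integrable (fun x => exp (-(π / v) * ‖x‖ ^ 2) * ‖sphereExt r g x‖ ^ 2) := by
  refine (integrable_gaussian hv).mul_bdd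
    (c := (M * (volume : Measure (EuclideanSpace ℝ (Fin n))).toSphere.real univ) ^ 2)
    ((measurable_sphereExt hg).norm.pow_const 2).aestronglyMeasurable (ae_of_all _ fun x => ?_)
  rw [norm_of_nonneg (by positivity)]
  have := norm_sphereExt_le (r := r) hM x
  gcongr

/-- The Gaussian-weighted energy of the extension operator is a quadratic form on the sphere with a
positive kernel. -/
theorem integral_gaussian_mul_sphereExt_sq {v r M : ℝ} (hv : 0 < v)
    {g : Metric.sphere (0 : EuclideanSpace ℝ (Fin n)) 1 → ℂ} (hg : Measurable g)
    (hM : ∀ ω, ‖g ω‖ ≤ M) :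
    ((∫ x, exp (-(π / v) * ‖x‖ ^ 2) * ‖sphereExt r g x‖ ^ 2 : ℝ) : ℂ) =
      ∫ p, (g p.1 * (starRingEnd ℂ) (g p.2)) *
        ((v ^ ((n : ℝ) / 2) * exp (-(π * v * ‖r • ((p.1 : EuclideanSpace ℝ (Fin n)) - p.2)‖ ^ 2)) :
          ℝ) : ℂ) ∂((volume : Measure (EuclideanSpace ℝ (Fin n))).toSphere.prod
            (volume : Measure (EuclideanSpace ℝ (Fin n))).toSphere) := by
  set σ := (volume : Measure (EuclideanSpace ℝ (Fin n))).toSphere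
  let F : EuclideanSpace ℝ (Fin n) → Metric.sphere (0 : EuclideanSpace ℝ (Fin n)) 1 ×
      Metric.sphere (0 : EuclideanSpace ℝ (Fin n)) 1 → ℂ := fun x p =>
    (g p.1 * (starRingEnd ℂ) (g p.2)) * (((exp (-(π / v) * ‖x‖ ^ 2) : ℝ) : ℂ) *
      Complex.exp (((2 * π * inner ℝ (r • ((p.1 : EuclideanSpace ℝ (Fin n)) - p.2)) x : ℝ) : ℂ) *
        Complex.I))
  have h1 : ∀ x, ((exp (-(π / v) * ‖x‖ ^ 2) * ‖sphereExt r g x‖ ^ 2 : ℝ) : ℂ) =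
      ∫ p, F x p ∂(σ.prod σ) := by
    intro x
    have hsq : ((‖sphereExt r g x‖ ^ 2 : ℝ) : ℂ) =
        sphereExt r g x * (starRingEnd ℂ) (sphereExt r g x) := by
      rw [Complex.mul_conj, Complex.normSq_eq_norm_sq]
    rw [Complex.ofReal_mul, hsq, sphereExt, ← integral_conj, ← integral_prod_mul,
      ← integral_const_mul]
    refine integral_congr_ae (ae_of_all _ fun p => ?_)
    simp only [F, map_mul, ← Complex.exp_conj, Complex.conj_ofReal, Complex.conj_I]
    rw [inner_smul_left, inner_sub_left]
    have : Complex.exp (((2 * π * ((starRingEnd ℝ) r * (inner ℝ (p.1 : EuclideanSpace ℝ (Fin n)) x -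
        inner ℝ (p.2 : EuclideanSpace ℝ (Fin n)) x)) : ℝ) : ℂ) * Complex.I) =
        Complex.exp (((2 * π * (r * inner ℝ (p.1 : EuclideanSpace ℝ (Fin n)) x) : ℝ) : ℂ) *
          Complex.I) *
        Complex.exp (((2 * π * (r * inner ℝ (p.2 : EuclideanSpace ℝ (Fin n)) x) : ℝ) : ℂ) *
          -Complex.I) := by
      rw [← Complex.exp_add]
      congr 1
      push_cast
      simp only [conj_trivial]
      ring
    rw [this]
    ring
  have hF : Integrable (Function.uncurry F) (volume.prod (σ.prod σ)) := by
    have hG : Integrable (fun q : EuclideanSpace ℝ (Fin n) ×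
        (Metric.sphere (0 : EuclideanSpace ℝ (Fin n)) 1 ×
          Metric.sphere (0 : EuclideanSpace ℝ (Fin n)) 1) =>
        exp (-(π / v) * ‖q.1‖ ^ 2) * (M * M)) (volume.prod (σ.prod σ)) :=
      (integrable_gaussian hv).mul_prod (integrable_const (M * M))
    refine hG.mono' ?_ (ae_of_all _ fun q => ?_)
    · refine Measurable.aestronglyMeasurable ?_
      refine Measurable.mul ?_ (Continuous.measurable ?_)
      · have h2 : Measurable fun q : EuclideanSpace ℝ (Fin n) ×
            (Metric.sphere (0 : EuclideanSpace ℝ (Fin n)) 1 ×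
              Metric.sphere (0 : EuclideanSpace ℝ (Fin n)) 1) => g q.2.2 := by fun_prop
        exact Measurable.mul (by fun_prop)
          (Complex.continuous_conj.measurable.comp h2)
      · fun_prop
    · simp only [Function.uncurry, F, norm_mul, Complex.norm_exp_ofReal_mul_I, Complex.norm_real,
        RCLike.norm_conj, mul_one, norm_of_nonneg (exp_pos _).le]
      rw [mul_comm]
      have := hM q.2.1
      have := hM q.2.2
      have := (norm_nonneg (g q.2.1)).trans (hM q.2.1)
      gcongr
  rw [← integral_complex_ofReal]
  simp_rw [h1]
  rw [integral_integral_swap hF]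
  refine integral_congr_ae (ae_of_all _ fun p => ?_)
  simp only [F]
  rw [integral_const_mul, integral_gaussian_mul_cexp hv]

theorem lintegral_gaussian_mul_sphereExt_sq {v r M : ℝ} (hv : 0 < v)
    {g : Metric.sphere (0 : EuclideanSpace ℝ (Fin n)) 1 → ℂ} (hg : Measurable g)
    (hM : ∀ ω, ‖g ω‖ ≤ M) :
    ∫⁻ x, ENNReal.ofReal (exp (-(π / v) * ‖x‖ ^ 2)) * ‖sphereExt r g x‖ₑ ^ 2 =
      ENNReal.ofReal (∫ x, exp (-(π / v) * ‖x‖ ^ 2) * ‖sphereExt r g x‖ ^ 2) := by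
  rw [ofReal_integral_eq_lintegral_ofReal (integrable_gaussian_mul_sphereExt_sq hv hg hM)
    (ae_of_all _ fun x => by positivity)]
  refine lintegral_congr fun x => ?_
  rw [ENNReal.ofReal_mul (exp_pos _).le, ENNReal.ofReal_pow (norm_nonneg _), ofReal_norm]

/-- The kernel of the quadratic form `g ↦ ∫ exp (-π |x|² / v) |sphereExt r g x|²`: the Fourier
transform of the Gaussian weight at the difference of two frequencies of modulus `r`. -/
noncomputable def sphereKernel (r v : ℝ) (ω ω' : Metric.sphere (0 : EuclideanSpace ℝ (Fin n)) 1) :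
    ℝ≥0∞ :=
  ENNReal.ofReal (v ^ ((n : ℝ) / 2) *
    exp (-(π * v * ‖r • ((ω : EuclideanSpace ℝ (Fin n)) - ω')‖ ^ 2)))

theorem sphereKernel_comm (r v : ℝ) (ω ω' : Metric.sphere (0 : EuclideanSpace ℝ (Fin n)) 1) :
    sphereKernel r v ω ω' = sphereKernel r v ω' ω := by
  simp only [sphereKernel, norm_smul, norm_sub_rev (ω : EuclideanSpace ℝ (Fin n))]

theorem measurable_sphereKernel (r : ℝ) : Measurable fun q : ℝ ×
    (Metric.sphere (0 : EuclideanSpace ℝ (Fin n)) 1 ×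
      Metric.sphere (0 : EuclideanSpace ℝ (Fin n)) 1) => sphereKernel r q.1 q.2.1 q.2.2 := by
  unfold sphereKernel
  refine ENNReal.measurable_ofReal.comp (Measurable.mul (by fun_prop) (Continuous.measurable ?_))
  fun_prop

/-- Schur's test for a symmetric positive kernel and the weight `1`. -/
theorem lintegral_mul_mul_kernel_le {α : Type*} [MeasurableSpace α] (σ : Measure α) [SFinite σ]
    {k : α → α → ℝ≥0∞} (hk : Measurable (Function.uncurry k)) (hsymm : ∀ x y, k x y = k y x)
    {a : α → ℝ≥0∞} (ha : Measurable a) :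
    ∫⁻ p, a p.1 * a p.2 * k p.1 p.2 ∂(σ.prod σ) ≤ ∫⁻ x, a x ^ 2 * ∫⁻ y, k x y ∂σ ∂σ := by
  have hk' : Measurable fun p : α × α => k p.1 p.2 := hk
  have hA : ∫⁻ x, a x ^ 2 * ∫⁻ y, k x y ∂σ ∂σ = ∫⁻ p, a p.1 ^ 2 * k p.1 p.2 ∂(σ.prod σ) := by
    rw [lintegral_prod _ (by fun_prop)]
    refine lintegral_congr fun x => ?_
    exact (lintegral_const_mul _ (hk'.comp measurable_prodMk_left)).symm
  have hB : ∫⁻ p, a p.1 ^ 2 * k p.1 p.2 ∂(σ.prod σ) =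
      ∫⁻ p, a p.2 ^ 2 * k p.1 p.2 ∂(σ.prod σ) := by
    rw [← lintegral_prod_swap]
    exact lintegral_congr fun p => by rw [hsymm]; rfl
  have hpt : ∀ p : α × α, 2 * (a p.1 * a p.2 * k p.1 p.2) ≤
      a p.1 ^ 2 * k p.1 p.2 + a p.2 ^ 2 * k p.1 p.2 := by
    intro p
    rw [← add_mul, ← mul_assoc, ← mul_assoc]
    refine mul_le_mul_left ?_ _
    generalize a p.1 = b
    generalize a p.2 = c
    induction b with
    | top => simp
    | coe b =>
      induction c with
      | top => simp
      | coe c => exact_mod_cast two_mul_le_add_sq b c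
  rw [hA, ← ENNReal.mul_le_mul_iff_right (a := 2) (by simp) (by simp)]
  refine (lintegral_const_mul_le _ _).trans ((lintegral_mono hpt).trans_eq ?_)
  rw [lintegral_add_left (by fun_prop), ← hB, two_mul]

theorem enorm_mul_conj_mul_sphereKernel {v : ℝ} (hv : 0 < v) (r : ℝ) (a b : ℂ)
    (ω ω' : Metric.sphere (0 : EuclideanSpace ℝ (Fin n)) 1) :
    ‖(a * (starRingEnd ℂ) b) * ((v ^ ((n : ℝ) / 2) *
      exp (-(π * v * ‖r • ((ω : EuclideanSpace ℝ (Fin n)) - ω')‖ ^ 2)) : ℝ) : ℂ)‖ₑ =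
      ‖a‖ₑ * ‖b‖ₑ * sphereKernel r v ω ω' := by
  rw [enorm_mul, enorm_mul, sphereKernel]
  congr 1
  · rw [← ofReal_norm ((starRingEnd ℂ) b), RCLike.norm_conj, ofReal_norm]
  · rw [← ofReal_norm, Complex.norm_real, norm_of_nonneg (by positivity)]

/-- Schur's test for the energy with a Gaussian weight. -/
theorem lintegral_gaussian_mul_sphereExt_sq_le {v r M : ℝ} (hv : 0 < v)
    {g : Metric.sphere (0 : EuclideanSpace ℝ (Fin n)) 1 → ℂ} (hg : Measurable g)
    (hM : ∀ ω, ‖g ω‖ ≤ M) :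
    ∫⁻ x, ENNReal.ofReal (exp (-(π / v) * ‖x‖ ^ 2)) * ‖sphereExt r g x‖ₑ ^ 2 ≤
      ∫⁻ ω, ‖g ω‖ₑ ^ 2 * ∫⁻ ω', sphereKernel r v ω ω'
        ∂(volume : Measure (EuclideanSpace ℝ (Fin n))).toSphere
        ∂(volume : Measure (EuclideanSpace ℝ (Fin n))).toSphere := by
  have h4 : ENNReal.ofReal (∫ x, exp (-(π / v) * ‖x‖ ^ 2) * ‖sphereExt r g x‖ ^ 2) =
      ‖((∫ x, exp (-(π / v) * ‖x‖ ^ 2) * ‖sphereExt r g x‖ ^ 2 : ℝ) : ℂ)‖ₑ := by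
    rw [← ofReal_norm, Complex.norm_real, norm_of_nonneg]
    exact integral_nonneg fun x => by positivity
  rw [lintegral_gaussian_mul_sphereExt_sq hv hg hM, h4, integral_gaussian_mul_sphereExt_sq hv hg hM]
  refine (enorm_integral_le_lintegral_enorm _).trans ?_
  simp_rw [enorm_mul_conj_mul_sphereKernel hv]
  have hk : Measurable fun q : Metric.sphere (0 : EuclideanSpace ℝ (Fin n)) 1 ×
      Metric.sphere (0 : EuclideanSpace ℝ (Fin n)) 1 => sphereKernel r v q.1 q.2 :=
    (measurable_sphereKernel r).comp (measurable_const.prodMk measurable_id)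
  exact lintegral_mul_mul_kernel_le _ (k := sphereKernel r v) hk (sphereKernel_comm r v) hg.enorm

/-- For constants the bound of Schur's test is an equality. -/
theorem lintegral_gaussian_mul_sphereExt_const_sq {v r : ℝ} (hv : 0 < v) (c : ℂ) :
    ∫⁻ x, ENNReal.ofReal (exp (-(π / v) * ‖x‖ ^ 2)) *
        ‖sphereExt (n := n) r (fun _ => c) x‖ₑ ^ 2 =
      ∫⁻ ω, ‖c‖ₑ ^ 2 * ∫⁻ ω', sphereKernel r v ω ω'
        ∂(volume : Measure (EuclideanSpace ℝ (Fin n))).toSphere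
        ∂(volume : Measure (EuclideanSpace ℝ (Fin n))).toSphere := by
  rw [lintegral_gaussian_mul_sphereExt_sq hv measurable_const (fun _ => le_rfl)]
  set σ := (volume : Measure (EuclideanSpace ℝ (Fin n))).toSphere
  have hk : Measurable fun q : Metric.sphere (0 : EuclideanSpace ℝ (Fin n)) 1 ×
      Metric.sphere (0 : EuclideanSpace ℝ (Fin n)) 1 => sphereKernel r v q.1 q.2 :=
    (measurable_sphereKernel r).comp (measurable_const.prodMk measurable_id)
  have h := integral_gaussian_mul_sphereExt_sq (n := n) (r := r) hv (g := fun _ => c)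
    measurable_const (fun _ => le_rfl)
  rw [integral_const_mul, integral_complex_ofReal, Complex.mul_conj, Complex.normSq_eq_norm_sq,
    ← Complex.ofReal_mul, Complex.ofReal_inj] at h
  rw [h, ENNReal.ofReal_mul (by positivity), ENNReal.ofReal_pow (norm_nonneg _), ofReal_norm,
    lintegral_const_mul _ (by fun_prop), ofReal_integral_eq_lintegral_ofReal,
    ← lintegral_prod (f := fun q => sphereKernel r v q.1 q.2) (by fun_prop)]
  · rfl
  · refine Integrable.of_bound (C := v ^ ((n : ℝ) / 2)) (Continuous.aestronglyMeasurable
      (by fun_prop)) (ae_of_all _ fun p => ?_)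
    rw [norm_of_nonneg (by positivity)]
    refine mul_le_of_le_one_right (by positivity) (exp_le_one_iff.2 ?_)
    have : 0 ≤ π * v * ‖r • ((p.1 : EuclideanSpace ℝ (Fin n)) - p.2)‖ ^ 2 := by positivity
    linarith
  · exact ae_of_all _ fun p => by positivity

end SphereExtension

/-! ### The sharp bound for the extension operator with the inverse square weight -/

section SphereWeighted

open Real Set

variable {n : ℕ}

/-- The inverse square weight is a superposition of Gaussians. -/
theorem lintegral_gaussian_eq_inv_sq {x : EuclideanSpace ℝ (Fin n)} (hx : x ≠ 0) :
    ∫⁻ v in Ioi (0 : ℝ), ENNReal.ofReal (π * (v ^ 2)⁻¹) *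
      ENNReal.ofReal (exp (-(π / v) * ‖x‖ ^ 2)) = ‖((‖x‖⁻¹ : ℝ) : ℂ)‖ₑ ^ 2 := by
  have hx' : 0 < ‖x‖ := norm_pos_iff.2 hx
  have hc : 0 < π * ‖x‖ ^ 2 := by positivity
  have h1 : ∫ v in Ioi (0 : ℝ), π * (v ^ 2)⁻¹ * exp (-(π / v) * ‖x‖ ^ 2) = (‖x‖⁻¹) ^ 2 := by
    have h2 := integral_comp_rpow_Ioi (fun y => exp (-(π * ‖x‖ ^ 2 * y))) (p := -1) (by norm_num)
    have h3 := integral_rpow_mul_exp_neg_mul_Ioi one_pos hc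
    simp only [sub_self, rpow_zero, one_mul, rpow_one, Gamma_one, mul_one] at h3
    rw [h3] at h2
    calc _ = π * ∫ v in Ioi (0 : ℝ), (|(-1 : ℝ)| * v ^ ((-1 : ℝ) - 1)) •
              exp (-(π * ‖x‖ ^ 2 * v ^ (-1 : ℝ))) := by
          rw [← integral_const_mul]
          refine setIntegral_congr_fun measurableSet_Ioi fun v (hv : 0 < v) => ?_
          have e1 : v ^ ((-1 : ℝ) - 1) = (v ^ 2)⁻¹ := by
            rw [show ((-1 : ℝ) - 1) = -((2 : ℕ) : ℝ) by norm_num, rpow_neg hv.le, rpow_natCast]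
          simp only [e1, rpow_neg_one, smul_eq_mul, abs_neg, abs_one, one_mul]
          rw [mul_assoc]
          congr 3
          field_simp
      _ = _ := by
          rw [h2]
          field_simp
  have hi : IntegrableOn (fun v : ℝ => π * (v ^ 2)⁻¹ * exp (-(π / v) * ‖x‖ ^ 2)) (Ioi 0) := by
    refine Integrable.of_integral_ne_zero ?_
    rw [h1]
    positivity
  rw [← ofReal_norm, Complex.norm_real, norm_of_nonneg (by positivity), ← ENNReal.ofReal_pow
    (by positivity), ← h1, ofReal_integral_eq_lintegral_ofReal hi
    (ae_of_all _ fun v => by positivity)]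
  refine lintegral_congr fun v => ?_
  rw [← ENNReal.ofReal_mul (by positivity)]

/-- The Fourier transform of the inverse square weight, restricted to differences of points of the
sphere, is a multiple of the Newton kernel. -/
theorem lintegral_sphereKernel (hn : 3 ≤ n) {r : ℝ} (hr : 0 < r)
    {ω ω' : Metric.sphere (0 : EuclideanSpace ℝ (Fin n)) 1} (h : ω ≠ ω') :
    ∫⁻ v in Ioi (0 : ℝ), ENNReal.ofReal (π * (v ^ 2)⁻¹) * sphereKernel r v ω ω' =
      ENNReal.ofReal (π ^ (2 - (n : ℝ) / 2) * Gamma ((n : ℝ) / 2 - 1) * (r ^ (n - 2))⁻¹) *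
        (ENNReal.ofReal (‖(ω : EuclideanSpace ℝ (Fin n)) - ω'‖ ^ (n - 2)))⁻¹ := by
  have hn' : (3 : ℝ) ≤ n := by exact_mod_cast hn
  have hρ : 0 < ‖(ω : EuclideanSpace ℝ (Fin n)) - ω'‖ := by
    rw [norm_pos_iff, sub_ne_zero]
    exact fun h' => h (Subtype.ext h')
  set ρ := ‖(ω : EuclideanSpace ℝ (Fin n)) - ω'‖
  have hG : 0 < Gamma ((n : ℝ) / 2 - 1) := Gamma_pos_of_pos (by linarith)
  have h3 := integral_rpow_mul_exp_neg_mul_Ioi (a := (n : ℝ) / 2 - 1) (r := π * (r * ρ) ^ 2)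
    (by linarith) (by positivity)
  have h1 : ∫ v in Ioi (0 : ℝ), π * (v ^ 2)⁻¹ * (v ^ ((n : ℝ) / 2) *
      exp (-(π * v * (r * ρ) ^ 2))) =
      π ^ (2 - (n : ℝ) / 2) * Gamma ((n : ℝ) / 2 - 1) * (r ^ (n - 2))⁻¹ * (ρ ^ (n - 2))⁻¹ := by
    calc _ = π * ∫ v in Ioi (0 : ℝ), v ^ ((n : ℝ) / 2 - 1 - 1) *
              exp (-(π * (r * ρ) ^ 2 * v)) := by
          rw [← integral_const_mul]
          refine setIntegral_congr_fun measurableSet_Ioi fun v (hv : 0 < v) => ?_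
          have e1 : v ^ ((n : ℝ) / 2 - 1 - 1) = (v ^ 2)⁻¹ * v ^ ((n : ℝ) / 2) := by
            rw [show (n : ℝ) / 2 - 1 - 1 = (n : ℝ) / 2 - ((2 : ℕ) : ℝ) by push_cast; ring,
              rpow_sub hv, rpow_natCast]
            ring
          simp only [e1]
          rw [show π * v * (r * ρ) ^ 2 = π * (r * ρ) ^ 2 * v by ring]
          ring
      _ = _ := by
          rw [h3, one_div, inv_rpow (by positivity), mul_rpow (by positivity) (by positivity)]
          have e2 : ((r * ρ) ^ 2) ^ ((n : ℝ) / 2 - 1) = r ^ (n - 2) * ρ ^ (n - 2) := by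
            rw [← mul_pow, ← rpow_natCast (r * ρ) (n - 2), ← rpow_natCast, ← rpow_mul
              (by positivity)]
            congr 1
            rw [Nat.cast_sub (by omega)]
            push_cast
            ring
          have e3 : π ^ (2 - (n : ℝ) / 2) = π * (π ^ ((n : ℝ) / 2 - 1))⁻¹ := by
            rw [← rpow_neg pi_pos.le]
            nth_rewrite 2 [← rpow_one π]
            rw [← rpow_add pi_pos]
            congr 1
            ring
          rw [e2, e3]
          field_simp
  have hi : IntegrableOn (fun v : ℝ => π * (v ^ 2)⁻¹ * (v ^ ((n : ℝ) / 2) *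
      exp (-(π * v * (r * ρ) ^ 2)))) (Ioi 0) := by
    refine Integrable.of_integral_ne_zero ?_
    rw [h1]
    positivity
  rw [← ENNReal.ofReal_inv_of_pos (by positivity), ← ENNReal.ofReal_mul (by positivity), ← h1,
    ofReal_integral_eq_lintegral_ofReal hi]
  · refine setLIntegral_congr_fun measurableSet_Ioi fun v (hv : 0 < v) => ?_
    simp only [sphereKernel, norm_smul, norm_of_nonneg hr.le]
    rw [← ENNReal.ofReal_mul (by positivity)]
  · filter_upwards [ae_restrict_mem measurableSet_Ioi] with v (hv : 0 < v)
    positivity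

/-- The surface measure of the sphere times the constant in the Fourier transform of `|x|⁻²`. -/
theorem ofReal_mul_toSphere_univ (hn : 3 ≤ n) :
    ENNReal.ofReal (π ^ (2 - (n : ℝ) / 2) * Gamma ((n : ℝ) / 2 - 1)) *
      (volume : Measure (EuclideanSpace ℝ (Fin n))).toSphere univ =
    ENNReal.ofReal (4 * π ^ 2 / ((n : ℝ) - 2)) := by
  have hn' : (3 : ℝ) ≤ n := by exact_mod_cast hn
  have : Nonempty (Fin n) := ⟨⟨0, by omega⟩⟩
  have hG : 0 < Gamma ((n : ℝ) / 2 - 1) := Gamma_pos_of_pos (by linarith)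
  rw [Measure.toSphere_apply_univ, EuclideanSpace.volume_ball]
  simp only [finrank_euclideanSpace, Fintype.card_fin, ENNReal.ofReal_one, one_pow, one_mul]
  rw [← ENNReal.ofReal_natCast, ← ENNReal.ofReal_mul (by positivity),
    ← ENNReal.ofReal_mul (by positivity)]
  congr 1
  have e1 : Gamma ((n : ℝ) / 2 + 1) = (n : ℝ) / 2 * (((n : ℝ) / 2 - 1) *
      Gamma ((n : ℝ) / 2 - 1)) := by
    have a := Gamma_add_one (s := (n : ℝ) / 2 - 1) (by linarith)
    rw [sub_add_cancel] at a
    rw [Gamma_add_one (by linarith), a]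
  have e2 : √π ^ n = π ^ ((n : ℝ) / 2) := by
    rw [sqrt_eq_rpow, ← rpow_natCast, ← rpow_mul pi_pos.le]
    congr 1; ring
  have e3 : π ^ (2 - (n : ℝ) / 2) * π ^ ((n : ℝ) / 2) = π ^ 2 := by
    rw [← rpow_add pi_pos, sub_add_cancel]; norm_cast
  rw [e1, e2]
  have h2 : (n : ℝ) - 2 ≠ 0 := by linarith
  have h3 : (n : ℝ) / 2 - 1 ≠ 0 := by linarith
  have h4 : (n : ℝ) ≠ 0 := by linarith
  rw [eq_div_iff h2]
  generalize Gamma ((n : ℝ) / 2 - 1) = G at hG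
  calc _ = (π ^ (2 - (n : ℝ) / 2) * π ^ ((n : ℝ) / 2)) * (2 * ((n : ℝ) - 2) / ((n : ℝ) / 2 - 1)) := by
        field_simp
    _ = _ := by
        rw [e3, show (n : ℝ) - 2 = 2 * ((n : ℝ) / 2 - 1) by ring]
        field_simp
        norm_num

/-- The bound that Schur's test gives for the inverse square weight. The mass of the superposed
kernels is the same at every point of the sphere, so it comes out as a factor. -/
theorem lintegral_lintegral_sphereKernel (hn : 3 ≤ n) {r : ℝ} (hr : 0 < r)
    {a : Metric.sphere (0 : EuclideanSpace ℝ (Fin n)) 1 → ℝ≥0∞} (ha : Measurable a) :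
    ∫⁻ v in Ioi (0 : ℝ), ENNReal.ofReal (π * (v ^ 2)⁻¹) * ∫⁻ ω, a ω * ∫⁻ ω', sphereKernel r v ω ω'
        ∂(volume : Measure (EuclideanSpace ℝ (Fin n))).toSphere
        ∂(volume : Measure (EuclideanSpace ℝ (Fin n))).toSphere =
      ENNReal.ofReal (4 * π ^ 2 / ((n : ℝ) - 2) * (r ^ (n - 2))⁻¹) *
        ∫⁻ ω, a ω ∂(volume : Measure (EuclideanSpace ℝ (Fin n))).toSphere := by
  set σ := (volume : Measure (EuclideanSpace ℝ (Fin n))).toSphere with hσ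
  have hn' : (3 : ℝ) ≤ n := by exact_mod_cast hn
  have hk := measurable_sphereKernel (n := n) r
  have hk2 : ∀ (v : ℝ) (ω : Metric.sphere (0 : EuclideanSpace ℝ (Fin n)) 1),
      Measurable (sphereKernel r v ω) := fun v ω =>
    hk.comp (measurable_const.prodMk measurable_prodMk_left)
  have hk3 : Measurable fun p : ℝ × Metric.sphere (0 : EuclideanSpace ℝ (Fin n)) 1 =>
      ∫⁻ ω', sphereKernel r p.1 p.2 ω' ∂σ :=
    (hk.comp ((by fun_prop : Measurable fun q : (ℝ × Metric.sphere (0 : EuclideanSpace ℝ (Fin n)) 1)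
      × Metric.sphere (0 : EuclideanSpace ℝ (Fin n)) 1 => (q.1.1, q.1.2, q.2)))).lintegral_prod_right'
  have hk4 : ∀ ω : Metric.sphere (0 : EuclideanSpace ℝ (Fin n)) 1,
      Measurable fun q : ℝ × Metric.sphere (0 : EuclideanSpace ℝ (Fin n)) 1 =>
        ENNReal.ofReal (π * (q.1 ^ 2)⁻¹) * sphereKernel r q.1 ω q.2 := fun ω =>
    (by fun_prop : Measurable fun q : ℝ × Metric.sphere (0 : EuclideanSpace ℝ (Fin n)) 1 =>
      ENNReal.ofReal (π * (q.1 ^ 2)⁻¹)).mul (hk.comp (by fun_prop :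
        Measurable fun q : ℝ × Metric.sphere (0 : EuclideanSpace ℝ (Fin n)) 1 => (q.1, ω, q.2)))
  calc _ = ∫⁻ v in Ioi (0 : ℝ), ∫⁻ ω, ENNReal.ofReal (π * (v ^ 2)⁻¹) * (a ω *
          ∫⁻ ω', sphereKernel r v ω ω' ∂σ) ∂σ := by
        refine lintegral_congr fun v => ?_
        exact (lintegral_const_mul _ (ha.mul (hk3.comp measurable_prodMk_left))).symm
    _ = ∫⁻ ω, (∫⁻ v in Ioi (0 : ℝ), ENNReal.ofReal (π * (v ^ 2)⁻¹) * (a ω *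
          ∫⁻ ω', sphereKernel r v ω ω' ∂σ)) ∂σ := by
        refine lintegral_lintegral_swap (Measurable.aemeasurable ?_)
        exact Measurable.mul (by fun_prop) ((ha.comp measurable_snd).mul hk3)
    _ = ∫⁻ ω, a ω * (∫⁻ v in Ioi (0 : ℝ), ∫⁻ ω', ENNReal.ofReal (π * (v ^ 2)⁻¹) *
          sphereKernel r v ω ω' ∂σ) ∂σ := by
        refine lintegral_congr fun ω => ?_
        rw [← lintegral_const_mul]
        · refine lintegral_congr fun v => ?_
          rw [lintegral_const_mul _ (hk2 v ω)]
          ring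
        · refine Measurable.lintegral_prod_right' (f := fun q : ℝ ×
            Metric.sphere (0 : EuclideanSpace ℝ (Fin n)) 1 => ENNReal.ofReal (π * (q.1 ^ 2)⁻¹) *
              sphereKernel r q.1 ω q.2) ?_
          exact hk4 ω
    _ = ∫⁻ ω, a ω * ENNReal.ofReal (4 * π ^ 2 / ((n : ℝ) - 2) * (r ^ (n - 2))⁻¹) ∂σ := by
        refine lintegral_congr fun ω => ?_
        congr 1
        rw [lintegral_lintegral_swap]
        · have hm : Measurable fun ω' : Metric.sphere (0 : EuclideanSpace ℝ (Fin n)) 1 =>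
              (ENNReal.ofReal (‖(ω' : EuclideanSpace ℝ (Fin n)) - ω‖ ^ (n - 2)))⁻¹ := by fun_prop
          have hN := lintegral_sphere_newton (n := n) (by omega) ω
          -- the potential is finite, so the singular point of the kernel has measure zero
          have hne : ∀ᵐ ω' ∂σ, ω ≠ ω' := by
            filter_upwards [ae_lt_top hm (by rw [hN]; exact measure_ne_top _ _)] with ω' hω' he
            rw [he, sub_self, norm_zero, zero_pow (by omega), ENNReal.ofReal_zero,
              ENNReal.inv_zero] at hω'
            exact lt_irrefl _ hω'
          rw [lintegral_congr_ae (g := fun ω' : Metric.sphere (0 : EuclideanSpace ℝ (Fin n)) 1 =>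
            ENNReal.ofReal (π ^ (2 - (n : ℝ) / 2) *
            Gamma ((n : ℝ) / 2 - 1) * (r ^ (n - 2))⁻¹) *
            (ENNReal.ofReal (‖(ω' : EuclideanSpace ℝ (Fin n)) - ω‖ ^ (n - 2)))⁻¹),
            lintegral_const_mul _ hm, hN, ENNReal.ofReal_mul, mul_right_comm,
            ofReal_mul_toSphere_univ hn, ← ENNReal.ofReal_mul]
          · have : 0 < (n : ℝ) - 2 := by linarith
            positivity
          · have hG : 0 < Gamma ((n : ℝ) / 2 - 1) := Gamma_pos_of_pos (by linarith)
            positivity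
          · filter_upwards [hne] with ω' hω'
            rw [lintegral_sphereKernel hn hr hω', norm_sub_rev]
        · refine Measurable.aemeasurable ?_
          exact hk4 ω
    _ = _ := by
        rw [lintegral_mul_const _ ha, mul_comm]

theorem lintegral_inv_sq_mul_eq (hn : 3 ≤ n) {F : EuclideanSpace ℝ (Fin n) → ℝ≥0∞}
    (hF : Measurable F) :
    ∫⁻ x, ‖((‖x‖⁻¹ : ℝ) : ℂ)‖ₑ ^ 2 * F x = ∫⁻ v in Ioi (0 : ℝ), ENNReal.ofReal (π * (v ^ 2)⁻¹) *
      ∫⁻ x, ENNReal.ofReal (exp (-(π / v) * ‖x‖ ^ 2)) * F x := by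
  have : Nonempty (Fin n) := ⟨⟨0, by omega⟩⟩
  have h0 : ∀ᵐ x : EuclideanSpace ℝ (Fin n), x ≠ 0 := by
    simp [ae_iff]
  have hE : Measurable fun q : EuclideanSpace ℝ (Fin n) × ℝ => exp (-(π / q.2) * ‖q.1‖ ^ 2) := by
    fun_prop
  calc _ = ∫⁻ x, ∫⁻ v in Ioi (0 : ℝ), ENNReal.ofReal (π * (v ^ 2)⁻¹) *
          (ENNReal.ofReal (exp (-(π / v) * ‖x‖ ^ 2)) * F x) := by
        refine lintegral_congr_ae ?_
        filter_upwards [h0] with x hx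
        rw [← lintegral_gaussian_eq_inv_sq hx, ← lintegral_mul_const _ (by fun_prop)]
        exact lintegral_congr fun v => mul_assoc _ _ _
    _ = ∫⁻ v in Ioi (0 : ℝ), ∫⁻ x, ENNReal.ofReal (π * (v ^ 2)⁻¹) *
          (ENNReal.ofReal (exp (-(π / v) * ‖x‖ ^ 2)) * F x) := by
        refine lintegral_lintegral_swap (Measurable.aemeasurable ?_)
        fun_prop
    _ = _ := by
        refine lintegral_congr fun v => ?_
        rw [lintegral_const_mul _ (by fun_prop)]

/-- The sharp weighted `L²` bound for the extension operator of the sphere of radius `r`. -/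
theorem lintegral_inv_sq_mul_sphereExt_le (hn : 3 ≤ n) {r M : ℝ} (hr : 0 < r)
    {g : Metric.sphere (0 : EuclideanSpace ℝ (Fin n)) 1 → ℂ} (hg : Measurable g)
    (hM : ∀ ω, ‖g ω‖ ≤ M) :
    ∫⁻ x, ‖((‖x‖⁻¹ : ℝ) : ℂ)‖ₑ ^ 2 * ‖sphereExt r g x‖ₑ ^ 2 ≤
      ENNReal.ofReal (4 * π ^ 2 / ((n : ℝ) - 2) * (r ^ (n - 2))⁻¹) *
        ∫⁻ ω, ‖g ω‖ₑ ^ 2 ∂(volume : Measure (EuclideanSpace ℝ (Fin n))).toSphere := by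
  rw [lintegral_inv_sq_mul_eq hn ((measurable_sphereExt hg).enorm.pow_const 2),
    ← lintegral_lintegral_sphereKernel hn hr (hg.enorm.pow_const 2)]
  refine setLIntegral_mono' measurableSet_Ioi fun v (hv : 0 < v) => ?_
  exact mul_le_mul_right (lintegral_gaussian_mul_sphereExt_sq_le hv hg hM) _

/-- Constants are extremal for the extension operator. -/
theorem lintegral_inv_sq_mul_sphereExt_const (hn : 3 ≤ n) {r : ℝ} (hr : 0 < r) (c : ℂ) :
    ∫⁻ x, ‖((‖x‖⁻¹ : ℝ) : ℂ)‖ₑ ^ 2 * ‖sphereExt (n := n) r (fun _ => c) x‖ₑ ^ 2 =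
      ENNReal.ofReal (4 * π ^ 2 / ((n : ℝ) - 2) * (r ^ (n - 2))⁻¹) *
        ∫⁻ _, ‖c‖ₑ ^ 2 ∂(volume : Measure (EuclideanSpace ℝ (Fin n))).toSphere := by
  rw [lintegral_inv_sq_mul_eq hn ((measurable_sphereExt measurable_const).enorm.pow_const 2),
    ← lintegral_lintegral_sphereKernel hn hr measurable_const]
  refine setLIntegral_congr_fun measurableSet_Ioi fun v (hv : 0 < v) => ?_
  rw [lintegral_gaussian_mul_sphereExt_const_sq hv]

end SphereWeighted

/-! ### Plancherel's theorem in time for a power phase -/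

section PowerPlancherel

open Real Set

theorem lintegral_comp_const_mul {c : ℝ} (hc : 0 < c) (f : ℝ → ℝ≥0∞) :
    ∫⁻ t, f (c * t) = ENNReal.ofReal c⁻¹ * ∫⁻ t, f t := by
  have h := lintegral_image_eq_lintegral_abs_deriv_mul (s := univ) (f := fun t : ℝ => c * t)
    (f' := fun _ => c) MeasurableSet.univ
    (fun x _ => (hasDerivAt_const_mul c).hasDerivWithinAt)
    (fun x _ y _ hxy => mul_left_cancel₀ hc.ne' hxy) f
  have hs : (fun t : ℝ => c * t) '' univ = univ := by
    rw [image_univ, (mul_left_surjective₀ hc.ne').range_eq]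
  rw [hs] at h
  simp only [Measure.restrict_univ, abs_of_pos hc] at h
  rw [h, lintegral_const_mul' _ _ ENNReal.ofReal_ne_top, ← mul_assoc,
    ← ENNReal.ofReal_mul (by positivity), inv_mul_cancel₀ hc.ne', ENNReal.ofReal_one, one_mul]

theorem lintegral_comp_rpow_Ioi {m : ℝ} (hm : 0 < m) (g : ℝ → ℝ≥0∞) :
    ∫⁻ r in Ioi (0 : ℝ), ENNReal.ofReal (m * r ^ (m - 1)) * g (r ^ m) =
      ∫⁻ s in Ioi (0 : ℝ), g s := by
  have a : (fun r : ℝ => r ^ m) '' (Ioi 0) = Ioi (0 : ℝ) := by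
    ext x
    constructor
    · rintro ⟨y, hy, rfl⟩
      exact rpow_pos_of_pos hy m
    · exact fun hx => ⟨x ^ (1 / m), rpow_pos_of_pos hx _, by
        simp [← rpow_mul (le_of_lt hx), hm.ne']⟩
  have h := lintegral_image_eq_lintegral_abs_deriv_mul measurableSet_Ioi
    (fun x hx => (hasDerivAt_rpow_const (p := m) (Or.inl (mem_Ioi.mp hx).ne')).hasDerivWithinAt)
    ((rpow_left_injOn hm.ne').mono (fun x (hx : 0 < x) => hx.le)) g
  rw [a] at h
  rw [h]
  refine setLIntegral_congr_fun measurableSet_Ioi fun x (hx : 0 < x) => ?_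
  rw [abs_of_nonneg (by positivity)]

/-- Plancherel's theorem in the time variable for the phase `(2πr) ^ m`: the substitution
`s = r ^ m` turns the oscillatory integral into an inverse Fourier transform. -/
theorem lintegral_enorm_integral_power_phase_sq {m a b M : ℝ} (hm : 0 < m) (ha : 0 < a)
    {h : ℝ → ℂ} (hh : Measurable h) (hM : ∀ r, 0 < r → ‖h r‖ ≤ M)
    (hsupp : ∀ r, 0 < r → h r ≠ 0 → a ≤ r ∧ r ≤ b) :
    ∫⁻ t : ℝ, ‖∫ r in Ioi (0 : ℝ), h r *
        Complex.exp (Complex.I * ((t * (2 * π * r) ^ m : ℝ) : ℂ))‖ₑ ^ 2 =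
      ∫⁻ r in Ioi (0 : ℝ), ENNReal.ofReal ((2 * π) ^ (1 - m) * m⁻¹ * r ^ (1 - m)) *
        ‖h r‖ₑ ^ 2 := by
  have h2π : (0 : ℝ) < 2 * π := by positivity
  let k : ℝ → ℂ := fun r => ((m⁻¹ * r ^ (1 - m) : ℝ) : ℂ) * h r
  let H : ℝ → ℂ := (Ioi (0 : ℝ)).indicator fun s => k (s ^ (1 / m))
  have hk : Measurable k := by fun_prop
  have hHm : Measurable H := (hk.comp (by fun_prop)).indicator measurableSet_Ioi
  have hroot : ∀ r : ℝ, 0 < r → (r ^ m) ^ (1 / m) = r := fun r hr => by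
    rw [← rpow_mul hr.le, mul_one_div_cancel hm.ne', rpow_one]
  have hHr : ∀ r : ℝ, 0 < r → H (r ^ m) = k r := fun r hr => by
    have : r ^ m ∈ Ioi (0 : ℝ) := rpow_pos_of_pos hr m
    simp only [H, indicator_of_mem this, hroot r hr]
  obtain ⟨B, hB⟩ : ∃ B, ∀ r ∈ Icc a b, ‖m⁻¹ * r ^ (1 - m)‖ ≤ B :=
    isCompact_Icc.exists_bound_of_continuousOn (f := fun r : ℝ => m⁻¹ * r ^ (1 - m))
      (continuousOn_const.mul (continuousOn_id.rpow_const
        fun x hx => Or.inl (ha.trans_le hx.1).ne'))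
  have hHsupp : ∀ s, s ∉ Icc (a ^ m) (b ^ m) → H s = 0 := by
    intro s hs
    by_contra hne
    have hs0 : 0 < s := by
      by_contra h0
      exact hne (indicator_of_notMem h0 _)
    have hr : 0 < s ^ (1 / m) := rpow_pos_of_pos hs0 _
    have hsr : (s ^ (1 / m)) ^ m = s := by
      rw [← rpow_mul hs0.le, one_div_mul_cancel hm.ne', rpow_one]
    rw [← hsr, hHr _ hr] at hne
    have := hsupp _ hr (right_ne_zero_of_mul hne)
    apply hs
    rw [← hsr]
    exact ⟨rpow_le_rpow ha.le this.1 hm.le, rpow_le_rpow hr.le this.2 hm.le⟩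
  have hHB : ∀ s, ‖H s‖ ≤ |B * M| := by
    intro s
    by_cases hne : H s = 0
    · rw [hne, norm_zero]; positivity
    have hs0 : 0 < s := by
      by_contra h0
      exact hne (indicator_of_notMem h0 _)
    have hr : 0 < s ^ (1 / m) := rpow_pos_of_pos hs0 _
    have hsr : (s ^ (1 / m)) ^ m = s := by
      rw [← rpow_mul hs0.le, one_div_mul_cancel hm.ne', rpow_one]
    rw [← hsr, hHr _ hr] at hne ⊢
    have h1 := hsupp _ hr (right_ne_zero_of_mul hne)
    refine le_trans ?_ (le_abs_self _)
    rw [norm_mul, Complex.norm_real]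
    have h2 := hB _ h1
    exact mul_le_mul h2 (hM _ hr) (norm_nonneg _) ((norm_nonneg _).trans h2)
  have hLp : ∀ p : ℝ≥0∞, MemLp H p := by
    intro p
    have h1 : MemLp H p (volume.restrict (Icc (a ^ m) (b ^ m))) :=
      MemLp.of_bound hHm.aestronglyMeasurable _ (ae_of_all _ hHB)
    rw [← memLp_indicator_iff_restrict measurableSet_Icc] at h1
    rwa [indicator_eq_self.2 fun s hs => by_contra fun h2 => hs (hHsupp s h2)] at h1
  have hU : ∀ t : ℝ, ∫ r in Ioi (0 : ℝ), h r *
      Complex.exp (Complex.I * ((t * (2 * π * r) ^ m : ℝ) : ℂ)) =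
      𝓕⁻ H ((2 * π) ^ (m - 1) * t) := by
    intro t
    rw [Real.fourierInv_eq']
    let g : ℝ → ℂ := fun s => Complex.exp (((2 * π * inner ℝ s ((2 * π) ^ (m - 1) * t) : ℝ) : ℂ) *
      Complex.I) • H s
    have e1 := setIntegral_eq_integral_of_forall_compl_eq_zero (μ := volume) (s := Ioi (0 : ℝ))
      (f := g) fun s hs => by simp only [g, H, indicator_of_notMem hs, smul_zero]
    rw [← e1, ← integral_comp_rpow_Ioi_of_pos (g := g) hm]
    refine setIntegral_congr_fun measurableSet_Ioi fun r (hr : 0 < r) => ?_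
    simp only [g, hHr r hr, k]
    have e2 : 2 * π * inner ℝ (r ^ m) ((2 * π) ^ (m - 1) * t) = t * (2 * π * r) ^ m := by
      rw [mul_rpow h2π.le hr.le, rpow_sub_one h2π.ne']
      simp only [RCLike.inner_apply, conj_trivial]
      field_simp
    have e3 : m * r ^ (m - 1) * (m⁻¹ * r ^ (1 - m)) = 1 := by
      rw [show 1 - m = -(m - 1) by ring, rpow_neg hr.le]
      have := (rpow_pos_of_pos hr (m - 1)).ne'
      field_simp
    rw [e2, smul_eq_mul, Complex.real_smul, mul_comm Complex.I]
    have e4 : (((m * r ^ (m - 1) : ℝ)) : ℂ) * ((m⁻¹ * r ^ (1 - m) : ℝ) : ℂ) = 1 := by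
      rw [← Complex.ofReal_mul, e3, Complex.ofReal_one]
    linear_combination (-(Complex.exp (((t * (2 * π * r) ^ m : ℝ) : ℂ) * Complex.I) * h r)) * e4
  simp_rw [hU]
  rw [lintegral_comp_const_mul (f := fun τ => ‖𝓕⁻ H τ‖ₑ ^ 2) (by positivity),
    lintegral_enorm_fourierInv_sq (memLp_one_iff_integrable.1 (hLp 1)) (hLp 2)]
  have e5 : ∫⁻ s, ‖H s‖ₑ ^ 2 = ∫⁻ s in Ioi (0 : ℝ), ‖H s‖ₑ ^ 2 := by
    rw [← lintegral_indicator measurableSet_Ioi, indicator_eq_self.2]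
    intro s hs
    by_contra h1
    simp [H, indicator_of_notMem h1] at hs
  rw [e5, ← lintegral_comp_rpow_Ioi hm, ← lintegral_const_mul' _ _ ENNReal.ofReal_ne_top]
  refine setLIntegral_congr_fun measurableSet_Ioi fun r (hr : 0 < r) => ?_
  simp only [hHr r hr, k]
  rw [enorm_mul, mul_pow, ← ofReal_norm ((_ : ℝ) : ℂ), Complex.norm_real,
    norm_of_nonneg (by positivity), ← ENNReal.ofReal_pow (by positivity), ← mul_assoc, ← mul_assoc,
    ← ENNReal.ofReal_mul (by positivity), ← ENNReal.ofReal_mul (by positivity)]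
  congr 2
  rw [show 1 - m = -(m - 1) by ring, rpow_neg hr.le, rpow_neg h2π.le]
  have := (rpow_pos_of_pos hr (m - 1)).ne'
  field_simp

end PowerPlancherel

/-! ### Evolutions with annular frequency support -/

section Annular

open Real Set

variable {n : ℕ}

/-- Bounded measurable functions supported in an annulus `{a ≤ ‖ξ‖ ≤ b}` with `0 < a`. They serve as
Fourier transforms of initial data for which all integrals converge absolutely. -/
structure IsAnnular (f : EuclideanSpace ℝ (Fin n) → ℂ) : Prop where
  measurable : Measurable f
  bounded : ∃ M, ∀ ξ, ‖f ξ‖ ≤ M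
  support : ∃ a b, 0 < a ∧ ∀ ξ, f ξ ≠ 0 → ‖ξ‖ ∈ Icc a b

theorem IsAnnular.sub {f g : EuclideanSpace ℝ (Fin n) → ℂ} (hf : IsAnnular f) (hg : IsAnnular g) :
    IsAnnular (f - g) := by
  obtain ⟨M, hM⟩ := hf.bounded
  obtain ⟨N, hN⟩ := hg.bounded
  obtain ⟨a, b, ha, hab⟩ := hf.support
  obtain ⟨c, d, hc, hcd⟩ := hg.support
  refine ⟨hf.measurable.sub hg.measurable,
    ⟨M + N, fun ξ => (norm_sub_le _ _).trans (add_le_add (hM ξ) (hN ξ))⟩,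
    ⟨min a c, max b d, lt_min ha hc, fun ξ hξ => ?_⟩⟩
  by_cases h : f ξ = 0
  · have h1 : g ξ ≠ 0 := fun h2 => hξ (by simp [h, h2])
    exact ⟨(min_le_right _ _).trans (hcd ξ h1).1, (hcd ξ h1).2.trans (le_max_right _ _)⟩
  · exact ⟨(min_le_left _ _).trans (hab ξ h).1, (hab ξ h).2.trans (le_max_left _ _)⟩

theorem IsAnnular.memLp {f : EuclideanSpace ℝ (Fin n) → ℂ} (hf : IsAnnular f) (p : ℝ≥0∞) :
    MemLp f p := by
  obtain ⟨M, hM⟩ := hf.bounded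
  obtain ⟨a, b, ha, hab⟩ := hf.support
  have h1 : MemLp f p (volume.restrict (Metric.closedBall 0 b)) :=
    have : IsFiniteMeasure (volume.restrict (Metric.closedBall (0 : EuclideanSpace ℝ (Fin n)) b)) :=
      ⟨by simpa using measure_closedBall_lt_top⟩
    MemLp.of_bound hf.measurable.aestronglyMeasurable M (ae_of_all _ hM)
  rw [← memLp_indicator_iff_restrict measurableSet_closedBall] at h1
  rwa [indicator_eq_self.2 fun ξ hξ => by simpa using (hab ξ hξ).2] at h1

theorem norm_smoothingSymbol (m t : ℝ) (ξ : EuclideanSpace ℝ (Fin n)) :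
    ‖smoothingSymbol m t ξ‖ = ‖ξ‖ ^ (m / 2 - 1) := by
  rw [smoothingSymbol, norm_mul, mul_comm Complex.I, Complex.norm_exp_ofReal_mul_I, mul_one,
    Complex.norm_real, norm_of_nonneg (by positivity)]

theorem measurable_smoothingSymbol (m : ℝ) :
    Measurable fun p : ℝ × EuclideanSpace ℝ (Fin n) => smoothingSymbol m p.1 ((2 * π) • p.2) := by
  unfold smoothingSymbol
  fun_prop

theorem IsAnnular.smoothingSymbol_mul {f : EuclideanSpace ℝ (Fin n) → ℂ} (hf : IsAnnular f)
    (m t : ℝ) : IsAnnular fun ξ => smoothingSymbol m t ((2 * π) • ξ) * f ξ := by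
  obtain ⟨M, hM⟩ := hf.bounded
  obtain ⟨a, b, ha, hab⟩ := hf.support
  refine ⟨((measurable_smoothingSymbol m).comp measurable_prodMk_left).mul hf.measurable, ?_,
    ⟨a, b, ha, fun ξ hξ => hab ξ (right_ne_zero_of_mul hξ)⟩⟩
  obtain ⟨B, hB⟩ : ∃ B, ∀ r ∈ Icc a b, ‖(2 * π * r) ^ (m / 2 - 1)‖ ≤ B :=
    isCompact_Icc.exists_bound_of_continuousOn (f := fun r : ℝ => (2 * π * r) ^ (m / 2 - 1))
      ((continuousOn_const.mul continuousOn_id).rpow_const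
        fun x hx => Or.inl (mul_pos (by positivity) (ha.trans_le hx.1)).ne')
  refine ⟨|B * M|, fun ξ => ?_⟩
  by_cases h : f ξ = 0
  · rw [h, mul_zero, norm_zero]; positivity
  refine le_trans ?_ (le_abs_self _)
  have h2 := hB _ (hab ξ h)
  rw [norm_mul, norm_smoothingSymbol, norm_smul, norm_of_nonneg (by positivity : 0 ≤ 2 * π),
    ← norm_of_nonneg (by positivity : 0 ≤ (2 * π * ‖ξ‖) ^ (m / 2 - 1))]
  exact mul_le_mul h2 (hM ξ) (norm_nonneg _) ((norm_nonneg _).trans h2)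

/-- The evolution with initial datum `𝓕⁻ f`, given by its absolutely convergent Fourier integral. -/
noncomputable def annularEvolution (m : ℝ) (f : EuclideanSpace ℝ (Fin n) → ℂ)
    (p : ℝ × EuclideanSpace ℝ (Fin n)) : ℂ :=
  𝓕⁻ (fun ξ => smoothingSymbol m p.1 ((2 * π) • ξ) * f ξ) p.2

theorem measurable_annularEvolution (m : ℝ) {f : EuclideanSpace ℝ (Fin n) → ℂ}
    (hf : IsAnnular f) : Measurable (annularEvolution m f) := by
  unfold annularEvolution
  simp_rw [Real.fourierInv_eq']
  refine (StronglyMeasurable.integral_prod_right' (f := fun q : (ℝ × EuclideanSpace ℝ (Fin n)) ×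
    EuclideanSpace ℝ (Fin n) => Complex.exp (((2 * π * inner ℝ q.2 q.1.2 : ℝ) : ℂ) * Complex.I) •
      (smoothingSymbol m q.1.1 ((2 * π) • q.2) * f q.2)) ?_).measurable
  have h1 : Measurable fun q : (ℝ × EuclideanSpace ℝ (Fin n)) × EuclideanSpace ℝ (Fin n) =>
      smoothingSymbol m q.1.1 ((2 * π) • q.2) := by
    unfold smoothingSymbol
    fun_prop
  have h2 := hf.measurable
  have h3 : Measurable fun q : (ℝ × EuclideanSpace ℝ (Fin n)) × EuclideanSpace ℝ (Fin n) =>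
      Complex.exp (((2 * π * inner ℝ q.2 q.1.2 : ℝ) : ℂ) * Complex.I) :=
    Continuous.measurable (by fun_prop)
  exact (h3.smul (h1.mul (h2.comp measurable_snd))).stronglyMeasurable

theorem annularEvolution_sub (m : ℝ) {f g : EuclideanSpace ℝ (Fin n) → ℂ}
    (hf : IsAnnular f) (hg : IsAnnular g) :
    annularEvolution m (f - g) = annularEvolution m f - annularEvolution m g := by
  ext p
  have h1 := memLp_one_iff_integrable.1 ((hf.smoothingSymbol_mul m p.1).memLp 1)
  have h2 := memLp_one_iff_integrable.1 ((hg.smoothingSymbol_mul m p.1).memLp 1)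
  simp only [annularEvolution, Pi.sub_apply, Real.fourierInv_eq, mul_sub]
  rw [← integral_sub]
  · simp_rw [smul_sub]
  · simpa using (Real.fourierIntegral_convergent_iff (-p.2)).2 h1
  · simpa using (Real.fourierIntegral_convergent_iff (-p.2)).2 h2

theorem isFourierMultiplierImage_annularEvolution (m t : ℝ)
    {f : EuclideanSpace ℝ (Fin n) → ℂ} (hf : IsAnnular f)
    {φ : Lp ℂ 2 (volume : Measure (EuclideanSpace ℝ (Fin n)))}
    (hφ : (𝓕 φ : Lp ℂ 2 (volume : Measure (EuclideanSpace ℝ (Fin n)))) =ᵐ[volume] f) :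
    IsFourierMultiplierImage (smoothingSymbol m t) φ (fun x => annularEvolution m f (t, x)) := by
  intro ψ
  have hF := hf.smoothingSymbol_mul m t
  have h1 := memLp_one_iff_integrable.1 (hF.memLp 1)
  have hae : (fun ξ => smoothingSymbol m t ((2 * π) • ξ) * f ξ * ψ ξ) =ᵐ[volume]
      fun ξ => smoothingSymbol m t ((2 * π) • ξ) *
        (𝓕 φ : Lp ℂ 2 (volume : Measure (EuclideanSpace ℝ (Fin n)))) ξ * ψ ξ := by
    filter_upwards [hφ] with ξ hξ
    rw [hξ]
  refine ⟨integrable_fourierInv_mul h1 _, ?_, ?_⟩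
  · refine Integrable.congr ?_ hae
    exact (hF.memLp 2).integrable_mul (ψ.memLp 2)
  · rw [← integral_congr_ae hae]
    refine (integral_fourierInv_mul_eq h1 (𝓕 ψ)).trans ?_
    rw [FourierTransform.fourierInv_fourier_eq]

theorem isSmoothedEvolution_annularEvolution (m : ℝ)
    {f : EuclideanSpace ℝ (Fin n) → ℂ} (hf : IsAnnular f)
    {φ : Lp ℂ 2 (volume : Measure (EuclideanSpace ℝ (Fin n)))}
    (hφ : (𝓕 φ : Lp ℂ 2 (volume : Measure (EuclideanSpace ℝ (Fin n)))) =ᵐ[volume] f) :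
    IsSmoothedEvolution m φ (annularEvolution m f) :=
  ⟨(measurable_annularEvolution m hf).aestronglyMeasurable,
    ae_of_all _ fun t => isFourierMultiplierImage_annularEvolution m t hf hφ⟩

/-- The evolution as an oscillatory integral over the radial frequency. -/
theorem annularEvolution_eq_integral_sphereExt (hn : 1 ≤ n) (m t : ℝ)
    {f : EuclideanSpace ℝ (Fin n) → ℂ} (hf : IsAnnular f) (x : EuclideanSpace ℝ (Fin n)) :
    annularEvolution m f (t, x) = ∫ r in Ioi (0 : ℝ),
      (((r ^ (n - 1) * (2 * π * r) ^ (m / 2 - 1) : ℝ) : ℂ) *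
        sphereExt r (fun ω => f (r • (ω : EuclideanSpace ℝ (Fin n)))) x) *
          Complex.exp (Complex.I * ((t * (2 * π * r) ^ m : ℝ) : ℂ)) := by
  have : Nonempty (Fin n) := ⟨⟨0, hn⟩⟩
  have h1 := memLp_one_iff_integrable.1 ((hf.smoothingSymbol_mul m t).memLp 1)
  have h2 : Integrable fun ξ : EuclideanSpace ℝ (Fin n) =>
      Complex.exp (((2 * π * inner ℝ ξ x : ℝ) : ℂ) * Complex.I) •
        (smoothingSymbol m t ((2 * π) • ξ) * f ξ) := by
    refine (h1.bdd_mul (c := 1) (f := fun ξ : EuclideanSpace ℝ (Fin n) =>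
      Complex.exp (((2 * π * inner ℝ ξ x : ℝ) : ℂ) * Complex.I))
      (Continuous.aestronglyMeasurable (by fun_prop)) (ae_of_all _ fun ξ => ?_))
    rw [Complex.norm_exp_ofReal_mul_I]
  rw [annularEvolution, Real.fourierInv_eq', integral_polar _ h2]
  refine setIntegral_congr_fun measurableSet_Ioi fun r (hr : 0 < r) => ?_
  simp only [finrank_euclideanSpace, Fintype.card_fin, sphereExt]
  rw [← integral_const_mul, ← integral_mul_const, ← integral_smul]
  refine integral_congr_ae (ae_of_all _ fun ω => ?_)
  have h3 : ‖(2 * π) • r • (ω : EuclideanSpace ℝ (Fin n))‖ = 2 * π * r := by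
    rw [norm_smul, norm_smul, norm_of_nonneg hr.le, norm_of_nonneg (by positivity : 0 ≤ 2 * π)]
    simp
  simp only [smoothingSymbol, h3, inner_smul_left, conj_trivial, smul_eq_mul, Complex.real_smul]
  push_cast
  ring

theorem measurable_sphereExt_radial {f : EuclideanSpace ℝ (Fin n) → ℂ} (hf : Measurable f) :
    Measurable fun p : ℝ × EuclideanSpace ℝ (Fin n) =>
      sphereExt p.1 (fun ω => f (p.1 • (ω : EuclideanSpace ℝ (Fin n)))) p.2 := by
  unfold sphereExt
  refine (StronglyMeasurable.integral_prod_right' (f := fun q : (ℝ × EuclideanSpace ℝ (Fin n)) ×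
    Metric.sphere (0 : EuclideanSpace ℝ (Fin n)) 1 => Complex.exp (((2 * π * (q.1.1 *
      inner ℝ (q.2 : EuclideanSpace ℝ (Fin n)) q.1.2) : ℝ) : ℂ) * Complex.I) *
        f (q.1.1 • (q.2 : EuclideanSpace ℝ (Fin n)))) ?_).measurable
  refine (Measurable.mul (Continuous.measurable ?_)
    (hf.comp (Continuous.measurable ?_))).stronglyMeasurable <;> fun_prop

/-- Plancherel's theorem in time, at a fixed point `x`. The powers of `r` are those of the Jacobian,
of the symbol, and of the substitution `s = r ^ m`. The terms with
`m` in the exponent cancel. -/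
theorem lintegral_enorm_annularEvolution_sq (hn : 2 ≤ n) {m : ℝ} (hm : 0 < m)
    {f : EuclideanSpace ℝ (Fin n) → ℂ} (hf : IsAnnular f) (x : EuclideanSpace ℝ (Fin n)) :
    ∫⁻ t, ‖annularEvolution m f (t, x)‖ₑ ^ 2 =
      ∫⁻ r in Ioi (0 : ℝ), ENNReal.ofReal ((2 * π * m)⁻¹ * r ^ (2 * n - 3)) *
        ‖sphereExt r (fun ω => f (r • (ω : EuclideanSpace ℝ (Fin n)))) x‖ₑ ^ 2 := by
  obtain ⟨M, hM⟩ := hf.bounded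
  obtain ⟨a, b, ha, hab⟩ := hf.support
  have hsupp : ∀ r, 0 < r →
      sphereExt r (fun ω => f (r • (ω : EuclideanSpace ℝ (Fin n)))) x ≠ 0 → r ∈ Icc a b := by
    intro r hr h
    by_contra hc
    apply h
    rw [sphereExt]
    refine integral_eq_zero_of_ae (ae_of_all _ fun ω => ?_)
    have : f (r • (ω : EuclideanSpace ℝ (Fin n))) = 0 := by
      by_contra h1
      have := hab _ h1
      rw [norm_smul, norm_of_nonneg hr.le] at this
      simp only [norm_eq_of_mem_sphere, mul_one] at this
      exact hc this
    simp [this]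
  simp_rw [annularEvolution_eq_integral_sphereExt (by omega) m _ hf x]
  let h : ℝ → ℂ := fun r => ((r ^ (n - 1) * (2 * π * r) ^ (m / 2 - 1) : ℝ) : ℂ) *
        sphereExt r (fun ω => f (r • (ω : EuclideanSpace ℝ (Fin n)))) x
  obtain ⟨B, hB⟩ : ∃ B, ∀ r ∈ Icc a b, ‖r ^ (n - 1) * (2 * π * r) ^ (m / 2 - 1)‖ ≤ B :=
    isCompact_Icc.exists_bound_of_continuousOn
      (f := fun r : ℝ => r ^ (n - 1) * (2 * π * r) ^ (m / 2 - 1))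
      ((continuousOn_id.pow _).mul ((continuousOn_const.mul continuousOn_id).rpow_const
        fun x hx => Or.inl (mul_pos (by positivity) (ha.trans_le hx.1)).ne'))
  have key := lintegral_enorm_integral_power_phase_sq (h := h) (b := b) hm ha (M := |B * (M *
    (volume : Measure (EuclideanSpace ℝ (Fin n))).toSphere.real univ)|) ?_ ?_ ?_
  · refine key.trans ?_
    refine setLIntegral_congr_fun measurableSet_Ioi fun r (hr : 0 < r) => ?_
    simp only [h]
    rw [enorm_mul, mul_pow, ← mul_assoc, ← ofReal_norm ((_ : ℝ) : ℂ), Complex.norm_real,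
      norm_of_nonneg (by positivity), ← ENNReal.ofReal_pow (by positivity),
      ← ENNReal.ofReal_mul (by positivity)]
    congr 2
    have h2π : (0 : ℝ) < 2 * π := by positivity
    have e1 : ((2 * π * r) ^ (m / 2 - 1)) ^ 2 = (2 * π) ^ (m - 1) * (2 * π)⁻¹ *
        (r ^ (m - 1) * r⁻¹) := by
      rw [← rpow_natCast, ← rpow_mul (by positivity), mul_rpow h2π.le hr.le,
        ← rpow_neg_one (2 * π), ← rpow_neg_one r, ← rpow_add h2π, ← rpow_add hr]
      congr 2 <;> push_cast <;> ring
    have e2 : (r ^ (n - 1)) ^ 2 * r⁻¹ = r ^ (2 * n - 3) := by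
      rw [← pow_mul, show (n - 1) * 2 = (2 * n - 3) + 1 by omega, pow_succ]
      field_simp
    rw [mul_pow, e1, ← e2, show 1 - m = -(m - 1) by ring, rpow_neg hr.le, rpow_neg h2π.le]
    have := (rpow_pos_of_pos hr (m - 1)).ne'
    have := (rpow_pos_of_pos h2π (m - 1)).ne'
    field_simp
  · have := (measurable_sphereExt_radial hf.measurable).comp
      (measurable_prodMk_right (y := x) : Measurable fun r : ℝ => (r, x))
    exact Measurable.mul (by fun_prop) this
  · intro r hr
    simp only [h]
    by_cases h0 : sphereExt r (fun ω => f (r • (ω : EuclideanSpace ℝ (Fin n)))) x = 0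
    · rw [h0, mul_zero, norm_zero]; positivity
    refine le_trans ?_ (le_abs_self _)
    have h2 := hB _ (hsupp r hr h0)
    rw [norm_mul, Complex.norm_real]
    exact mul_le_mul h2 (norm_sphereExt_le (fun ω => hM _) x) (norm_nonneg _)
      ((norm_nonneg _).trans h2)
  · intro r hr h0
    exact hsupp r hr (right_ne_zero_of_mul h0)

end Annular

/-! ### The sharp inequality for annular data -/

section SharpIdentity

open Real Set

variable {n : ℕ}

theorem weightedSpaceTimeNorm_sq {U : ℝ × EuclideanSpace ℝ (Fin n) → ℂ} (hU : Measurable U) :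
    weightedSpaceTimeNorm U ^ 2 =
      ∫⁻ x : EuclideanSpace ℝ (Fin n), ‖((‖x‖⁻¹ : ℝ) : ℂ)‖ₑ ^ 2 * ∫⁻ t, ‖U (t, x)‖ₑ ^ 2 := by
  have h2 : Measurable fun p : ℝ × EuclideanSpace ℝ (Fin n) =>
      ‖((‖p.2‖⁻¹ : ℝ) : ℂ) * U p‖ₑ ^ 2 := by fun_prop
  rw [weightedSpaceTimeNorm, eLpNorm_two_sq, Measure.volume_eq_prod, lintegral_prod_symm' _ h2]
  refine lintegral_congr fun x => ?_
  simp only [enorm_mul, mul_pow]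
  exact lintegral_const_mul _ (by fun_prop)

theorem lintegral_mul_lintegral_mul_swap {α β : Type*} [MeasurableSpace α] [MeasurableSpace β]
    {μ : Measure α} {ν : Measure β} [SFinite μ] [SFinite ν] {w : α → ℝ≥0∞} {c : β → ℝ≥0∞}
    {F : β × α → ℝ≥0∞} (hw : Measurable w) (hc : Measurable c) (hF : Measurable F) :
    ∫⁻ x, w x * ∫⁻ r, c r * F (r, x) ∂ν ∂μ = ∫⁻ r, c r * ∫⁻ x, w x * F (r, x) ∂μ ∂ν := by
  calc _ = ∫⁻ x, ∫⁻ r, c r * (w x * F (r, x)) ∂ν ∂μ := by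
        refine lintegral_congr fun x => ?_
        rw [← lintegral_const_mul _ (by fun_prop)]
        exact lintegral_congr fun r => by ring
    _ = ∫⁻ r, ∫⁻ x, c r * (w x * F (r, x)) ∂μ ∂ν :=
        lintegral_lintegral_swap (Measurable.aemeasurable (by fun_prop))
    _ = _ := lintegral_congr fun r => lintegral_const_mul _ (by fun_prop)

theorem weightedSpaceTimeNorm_annularEvolution_sq (hn : 3 ≤ n) {m : ℝ} (hm : 0 < m)
    {f : EuclideanSpace ℝ (Fin n) → ℂ} (hf : IsAnnular f) :
    weightedSpaceTimeNorm (annularEvolution m f) ^ 2 =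
      ∫⁻ r in Ioi (0 : ℝ), ENNReal.ofReal ((2 * π * m)⁻¹ * r ^ (2 * n - 3)) *
        ∫⁻ x : EuclideanSpace ℝ (Fin n), ‖((‖x‖⁻¹ : ℝ) : ℂ)‖ₑ ^ 2 *
          ‖sphereExt r (fun ω => f (r • (ω : EuclideanSpace ℝ (Fin n)))) x‖ₑ ^ 2 := by
  have hS := (measurable_sphereExt_radial hf.measurable).enorm.pow_const 2
  rw [weightedSpaceTimeNorm_sq (measurable_annularEvolution m hf)]
  simp_rw [lintegral_enorm_annularEvolution_sq (by omega : 2 ≤ n) hm hf]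
  exact lintegral_mul_lintegral_mul_swap (by fun_prop) (by fun_prop) hS

theorem eLpNorm_two_sq_polar (hn : 1 ≤ n) {f : EuclideanSpace ℝ (Fin n) → ℂ} (hf : Measurable f) :
    eLpNorm f 2 volume ^ 2 = ∫⁻ r in Ioi (0 : ℝ), ENNReal.ofReal (r ^ (n - 1)) *
      ∫⁻ ω : Metric.sphere (0 : EuclideanSpace ℝ (Fin n)) 1,
        ‖f (r • (ω : EuclideanSpace ℝ (Fin n)))‖ₑ ^ 2
          ∂(volume : Measure (EuclideanSpace ℝ (Fin n))).toSphere := by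
  have : Nonempty (Fin n) := ⟨⟨0, hn⟩⟩
  rw [eLpNorm_two_sq, lintegral_polar _ (by fun_prop)]
  simp

theorem radial_constants_mul (hn : 3 ≤ n) {m : ℝ} (hm : 0 < m) {r : ℝ} (hr : 0 < r) (A : ℝ≥0∞) :
    ENNReal.ofReal ((2 * π * m)⁻¹ * r ^ (2 * n - 3)) *
      (ENNReal.ofReal (4 * π ^ 2 / ((n : ℝ) - 2) * (r ^ (n - 2))⁻¹) * A) =
    ENNReal.ofReal (2 * π / (m * ((n : ℝ) - 2))) * (ENNReal.ofReal (r ^ (n - 1)) * A) := by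
  have hn' : (3 : ℝ) ≤ n := by exact_mod_cast hn
  have hn2 : 0 < (n : ℝ) - 2 := by linarith
  rw [← mul_assoc, ← mul_assoc, ← ENNReal.ofReal_mul (by positivity),
    ← ENNReal.ofReal_mul (by positivity)]
  congr 2
  have : r ^ (2 * n - 3) = r ^ (n - 1) * r ^ (n - 2) := by
    rw [← pow_add]; congr 1; omega
  rw [this]
  field_simp
  norm_num

theorem ofReal_sqrt_mul_sq {κ : ℝ} (hκ : 0 ≤ κ) (a : ℝ≥0∞) :
    (ENNReal.ofReal (√κ) * a) ^ 2 = ENNReal.ofReal κ * a ^ 2 := by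
  rw [mul_pow, ← ENNReal.ofReal_pow (sqrt_nonneg _), sq_sqrt hκ]

/-- The sharp inequality for annular data: on each frequency sphere it is the sharp bound for the
extension operator. -/
theorem weightedSpaceTimeNorm_annularEvolution_le (hn : 3 ≤ n) {m : ℝ} (hm : 0 < m)
    {f : EuclideanSpace ℝ (Fin n) → ℂ} (hf : IsAnnular f) :
    weightedSpaceTimeNorm (annularEvolution m f) ≤
      ENNReal.ofReal (√(2 * π / (m * ((n : ℝ) - 2)))) * eLpNorm f 2 volume := by
  have hn' : (3 : ℝ) ≤ n := by exact_mod_cast hn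
  have hn2 : 0 < (n : ℝ) - 2 := by linarith
  obtain ⟨M, hM⟩ := hf.bounded
  rw [← (ENNReal.pow_right_strictMono two_ne_zero).le_iff_le]
  rw [ofReal_sqrt_mul_sq (by positivity), weightedSpaceTimeNorm_annularEvolution_sq hn hm hf,
    eLpNorm_two_sq_polar (by omega) hf.measurable, ← lintegral_const_mul' _ _ ENNReal.ofReal_ne_top]
  refine setLIntegral_mono' measurableSet_Ioi fun r (hr : 0 < r) => ?_
  rw [← radial_constants_mul hn hm hr]
  refine mul_le_mul_right (lintegral_inv_sq_mul_sphereExt_le hn hr ?_ (fun ω => hM _)) _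
  exact hf.measurable.comp (Continuous.measurable (by fun_prop))

/-- Radial data are extremal. -/
theorem weightedSpaceTimeNorm_annularEvolution_radial (hn : 3 ≤ n) {m : ℝ} (hm : 0 < m)
    {f : EuclideanSpace ℝ (Fin n) → ℂ} (hf : IsAnnular f) {f₀ : ℝ → ℂ} (hrad : ∀ ξ, f ξ = f₀ ‖ξ‖) :
    weightedSpaceTimeNorm (annularEvolution m f) =
      ENNReal.ofReal (√(2 * π / (m * ((n : ℝ) - 2)))) * eLpNorm f 2 volume := by
  have hn' : (3 : ℝ) ≤ n := by exact_mod_cast hn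
  have hn2 : 0 < (n : ℝ) - 2 := by linarith
  refine (ENNReal.pow_right_strictMono two_ne_zero).injective ?_
  rw [ofReal_sqrt_mul_sq (by positivity), weightedSpaceTimeNorm_annularEvolution_sq hn hm hf,
    eLpNorm_two_sq_polar (by omega) hf.measurable, ← lintegral_const_mul' _ _ ENNReal.ofReal_ne_top]
  refine setLIntegral_congr_fun measurableSet_Ioi fun r (hr : 0 < r) => ?_
  have h1 : ∀ ω : Metric.sphere (0 : EuclideanSpace ℝ (Fin n)) 1,
      f (r • (ω : EuclideanSpace ℝ (Fin n))) = f₀ r := fun ω => by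
    rw [hrad, norm_smul, norm_of_nonneg hr.le]
    simp
  simp only [h1]
  rw [← radial_constants_mul hn hm hr, lintegral_inv_sq_mul_sphereExt_const hn hr]

end SharpIdentity

/-! ### Powers of the norm times Schwartz functions -/

section PowerWeight

open Real Set

variable {n : ℕ}

/-- The hypothesis `hs` makes the density `r ^ (n - 1 + 2 * s)` of `‖ξ‖ ^ (2 * s)` in polar
coordinates bounded near `0`, which is more than integrability requires. -/
theorem memLp_norm_rpow_mul_schwartz (hn : 1 ≤ n) {s : ℝ} (hs : 0 ≤ (n : ℝ) - 1 + 2 * s)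
    (ψ : 𝓢(EuclideanSpace ℝ (Fin n), ℂ)) :
    MemLp (fun ξ => ((‖ξ‖ ^ s : ℝ) : ℂ) * ψ ξ) 2 := by
  have : Nonempty (Fin n) := ⟨⟨0, hn⟩⟩
  obtain ⟨K, hK⟩ := exists_nat_ge ((n : ℝ) + 1 + 2 * s)
  obtain ⟨C, hC⟩ : ∃ C, ∀ ξ, (1 + ‖ξ‖) ^ K * ‖ψ ξ‖ ≤ C := by
    have h := SchwartzMap.one_add_le_sup_seminorm_apply (𝕜 := ℝ) (m := (K, 0)) (k := K) (n := 0)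
      le_rfl le_rfl ψ
    simp only [norm_iteratedFDeriv_zero] at h
    exact ⟨_, h⟩
  have hmeas : Measurable fun ξ => ((‖ξ‖ ^ s : ℝ) : ℂ) * ψ ξ :=
    Measurable.mul (by fun_prop) ψ.continuous.measurable
  rw [memLp_two_iff_integrable_sq_norm hmeas.aestronglyMeasurable]
  have h1 : Integrable (fun ξ : EuclideanSpace ℝ (Fin n) =>
      C ^ 2 * (‖ξ‖ ^ (2 * s) * (1 + ‖ξ‖) ^ (-(2 * K : ℝ)))) := by
    refine Integrable.const_mul ?_ _
    rw [integrable_fun_norm_addHaar (volume : Measure (EuclideanSpace ℝ (Fin n)))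
      (f := fun y => y ^ (2 * s) * (1 + y) ^ (-(2 * K : ℝ)))]
    have h2 : IntegrableOn (fun y : ℝ => (y + 1) ^ (-(2 : ℝ))) (Ioi 0) :=
      integrableOn_add_rpow_Ioi_of_lt (by norm_num) (by norm_num)
    refine h2.mono' (Measurable.aestronglyMeasurable (by fun_prop)) ?_
    filter_upwards [ae_restrict_mem measurableSet_Ioi] with y (hy : 0 < y)
    rw [norm_of_nonneg (by positivity)]
    simp only [finrank_euclideanSpace, Fintype.card_fin, smul_eq_mul]
    rw [← mul_assoc, ← rpow_natCast, Nat.cast_sub hn, ← rpow_add hy, Nat.cast_one]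
    calc y ^ ((n : ℝ) - 1 + 2 * s) * (1 + y) ^ (-(2 * K : ℝ))
        ≤ (1 + y) ^ ((n : ℝ) - 1 + 2 * s) * (1 + y) ^ (-(2 * K : ℝ)) := by
          gcongr
          linarith
      _ = (1 + y) ^ ((n : ℝ) - 1 + 2 * s + -(2 * K : ℝ)) := by
          rw [← rpow_add (by positivity)]
      _ ≤ (1 + y) ^ (-(2 : ℝ)) := by
          refine rpow_le_rpow_of_exponent_le (by linarith) ?_
          have : (0 : ℝ) ≤ K := K.cast_nonneg
          linarith
      _ = _ := by rw [add_comm]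
  refine h1.mono' (hmeas.norm.pow_const 2).aestronglyMeasurable (ae_of_all _ fun ξ => ?_)
  have hp : 0 < 1 + ‖ξ‖ := by positivity
  rw [norm_mul, Complex.norm_real, norm_of_nonneg (by positivity : 0 ≤ ‖ξ‖ ^ s),
    norm_of_nonneg (by positivity), mul_pow]
  have e1 : (‖ξ‖ ^ s) ^ 2 = ‖ξ‖ ^ (2 * s) := by
    rw [← rpow_natCast, ← rpow_mul (norm_nonneg _), mul_comm]; norm_num
  have e2 : (1 + ‖ξ‖) ^ (-(2 * K : ℝ)) = (((1 + ‖ξ‖) ^ K) ^ 2)⁻¹ := by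
    rw [rpow_neg hp.le, ← pow_mul, ← rpow_natCast]
    congr 2
    push_cast; ring
  rw [e1, e2]
  have h3 : ‖ψ ξ‖ ^ 2 ≤ C ^ 2 * (((1 + ‖ξ‖) ^ K) ^ 2)⁻¹ := by
    rw [← div_eq_mul_inv, le_div_iff₀ (by positivity), ← mul_pow]
    refine pow_le_pow_left₀ (by positivity) ?_ 2
    rw [mul_comm]
    exact hC ξ
  calc _ ≤ ‖ξ‖ ^ (2 * s) * (C ^ 2 * (((1 + ‖ξ‖) ^ K) ^ 2)⁻¹) := by gcongr
    _ = _ := by ring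

end PowerWeight

/-! ### Density of annular data and convergence of time slices -/

section Extension

open Real Set Filter Topology

variable {n : ℕ}

/-- Annular functions are dense in `L²`: truncate at small and large frequencies and at large
values. -/
theorem exists_isAnnular_eLpNorm_sub_le (hn : 1 ≤ n) {f : EuclideanSpace ℝ (Fin n) → ℂ}
    (hfm : Measurable f) (hf : MemLp f 2) {ε : ℝ≥0∞} (hε : 0 < ε) :
    ∃ g, IsAnnular g ∧ eLpNorm (g - f) 2 volume ≤ ε := by
  have : Nonempty (Fin n) := ⟨⟨0, hn⟩⟩
  let A : ℕ → Set (EuclideanSpace ℝ (Fin n)) := fun k =>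
    {ξ | ‖ξ‖ ∈ Icc ((k : ℝ) + 1)⁻¹ (k + 1) ∧ ‖f ξ‖ ≤ k}
  have hA : ∀ k, MeasurableSet (A k) := fun k =>
    (measurable_norm measurableSet_Icc).inter (hfm.norm measurableSet_Iic)
  let g : ℕ → EuclideanSpace ℝ (Fin n) → ℂ := fun k => (A k).indicator f
  have hg : ∀ k, IsAnnular (g k) := fun k => by
    refine ⟨hfm.indicator (hA k), ⟨k, fun ξ => ?_⟩, ⟨((k : ℝ) + 1)⁻¹, k + 1, by positivity,
      fun ξ hξ => (mem_of_indicator_ne_zero hξ).1⟩⟩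
    by_cases h : ξ ∈ A k
    · simpa only [g, indicator_of_mem h] using h.2
    · simp only [g, indicator_of_notMem h, norm_zero]; positivity
  have hlim : Tendsto (fun k => ∫⁻ ξ, ‖(g k - f) ξ‖ₑ ^ 2) atTop
      (𝓝 (∫⁻ _ : EuclideanSpace ℝ (Fin n), 0)) := by
    refine tendsto_lintegral_of_dominated_convergence (fun ξ => ‖f ξ‖ₑ ^ 2)
      (fun k => (((hg k).measurable.sub hfm).enorm.pow_const 2)) (fun k => ae_of_all _ fun ξ => ?_)
      ?_ ?_
    · by_cases h : ξ ∈ A k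
      · simp [g, indicator_of_mem h]
      · simp [g, indicator_of_notMem h]
    · rw [← eLpNorm_two_sq]
      exact ENNReal.pow_ne_top hf.2.ne
    · have h0 : ∀ᵐ ξ : EuclideanSpace ℝ (Fin n), ξ ≠ 0 := by simp [ae_iff]
      filter_upwards [h0] with ξ hξ
      have hξ' : 0 < ‖ξ‖ := norm_pos_iff.2 hξ
      refine tendsto_const_nhds.congr' ?_
      obtain ⟨N, hN⟩ := exists_nat_ge (max (max ‖ξ‖ ‖ξ‖⁻¹) ‖f ξ‖)
      filter_upwards [eventually_ge_atTop N] with k hk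
      have hk' : (N : ℝ) ≤ k := by exact_mod_cast hk
      simp only [max_le_iff] at hN
      have h : ξ ∈ A k := by
        refine ⟨⟨?_, by linarith [hN.1.1]⟩, by linarith [hN.2]⟩
        rw [inv_le_comm₀ (by positivity) hξ']
        linarith [hN.1.2]
      simp [g, indicator_of_mem h]
  rw [lintegral_zero] at hlim
  obtain ⟨k, hk⟩ := (hlim.eventually (ge_mem_nhds (ENNReal.pow_pos hε 2))).exists
  refine ⟨g k, hg k, ?_⟩
  rw [← eLpNorm_two_sq] at hk
  exact (ENNReal.pow_right_strictMono two_ne_zero).le_iff_le.1 hk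

/-- The pairing with a fixed square integrable function is continuous in `L²`. -/
theorem tendsto_integral_mul_of_tendsto_eLpNorm {α : Type*} [MeasurableSpace α] {μ : Measure α}
    {F : ℕ → α → ℂ} {f h : α → ℂ} (hF : ∀ k, MemLp (F k) 2 μ) (hf : MemLp f 2 μ)
    (hh : MemLp h 2 μ) (hlim : Tendsto (fun k => eLpNorm (F k - f) 2 μ) atTop (𝓝 0)) :
    Tendsto (fun k => ∫ x, F k x * h x ∂μ) atTop (𝓝 (∫ x, f x * h x ∂μ)) := by
  refine tendsto_integral_of_L1' _ (hf.integrable_mul hh).1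
    (Eventually.of_forall fun k => (hF k).integrable_mul hh) ?_
  have h1 : Tendsto (fun k => eLpNorm (F k - f) 2 μ * eLpNorm h 2 μ) atTop (𝓝 0) := by
    have := ENNReal.Tendsto.mul_const hlim (Or.inr hh.2.ne)
    rwa [zero_mul] at this
  refine tendsto_of_tendsto_of_tendsto_of_le_of_le tendsto_const_nhds h1 (fun _ => zero_le)
    fun k => ?_
  have h2 := eLpNorm_smul_le_mul_eLpNorm (p := 2) (q := 2) (r := 1) hh.1 ((hF k).sub hf).1
  refine le_trans (le_of_eq ?_) h2
  congr 1
  ext x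
  simp [sub_mul]

/-- For `n ≥ 3` the symbol is square integrable near the origin for every `m > 0`, so that it may be
paired with `L²` functions. -/
theorem memLp_smoothingSymbol_mul_schwartz (hn : 3 ≤ n) {m : ℝ} (hm : 0 < m) (t : ℝ)
    (ψ : 𝓢(EuclideanSpace ℝ (Fin n), ℂ)) :
    MemLp (fun ξ => smoothingSymbol m t ((2 * π) • ξ) * ψ ξ) 2 := by
  have hn' : (3 : ℝ) ≤ n := by exact_mod_cast hn
  have h1 := (memLp_norm_rpow_mul_schwartz (n := n) (by omega) (s := m / 2 - 1) (by linarith)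
    ψ).const_mul (((2 * π) ^ (m / 2 - 1) : ℝ) : ℂ)
  refine h1.mono ?_ (ae_of_all _ fun ξ => ?_)
  · exact (((measurable_smoothingSymbol m).comp measurable_prodMk_left).mul
      ψ.continuous.measurable).aestronglyMeasurable
  · rw [norm_mul, norm_smoothingSymbol, norm_smul, norm_of_nonneg (by positivity : 0 ≤ 2 * π),
      mul_rpow (by positivity) (norm_nonneg _), norm_mul, norm_mul, Complex.norm_real,
      Complex.norm_real, norm_of_nonneg (by positivity : 0 ≤ (2 * π) ^ (m / 2 - 1)),
      norm_of_nonneg (by positivity : 0 ≤ ‖ξ‖ ^ (m / 2 - 1)), mul_assoc]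

/-- If the time-integrated `L²` distances are summable, then almost every time slice converges. -/
theorem ae_tendsto_eLpNorm_slice {α : Type*} [MeasurableSpace α] {μ : Measure α} [SFinite μ]
    {β : Type*} [MeasurableSpace β] {ν : Measure β} [SFinite ν]
    {W : ℕ → α × β → ℂ} (hW : ∀ k, Measurable (W k))
    (hsum : ∑' k, eLpNorm (W k) 2 (μ.prod ν) ^ 2 ≠ ∞) :
    ∀ᵐ t ∂μ, Tendsto (fun k => eLpNorm (fun x => W k (t, x)) 2 ν) atTop (𝓝 0) := by
  have hm : ∀ k, Measurable fun t => ∫⁻ x, ‖W k (t, x)‖ₑ ^ 2 ∂ν := fun k =>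
    ((hW k).enorm.pow_const 2).lintegral_prod_right'
  have h1 : ∫⁻ t, ∑' k, ∫⁻ x, ‖W k (t, x)‖ₑ ^ 2 ∂ν ∂μ ≠ ∞ := by
    rw [lintegral_tsum fun k => (hm k).aemeasurable]
    convert hsum using 3 with k
    rw [eLpNorm_two_sq, lintegral_prod _ ((hW k).enorm.pow_const 2).aemeasurable]
  filter_upwards [ae_lt_top (Measurable.tsum hm) h1] with t ht
  have h2 := ENNReal.tendsto_atTop_zero_of_tsum_ne_top ht.ne
  simp_rw [← eLpNorm_two_sq] at h2
  have h3 := (ENNReal.continuous_rpow_const (y := (2 : ℝ)⁻¹)).tendsto 0 |>.comp h2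
  rw [ENNReal.zero_rpow_of_pos (by norm_num)] at h3
  refine h3.congr fun k => ?_
  simp only [Function.comp]
  rw [← ENNReal.rpow_natCast, ← ENNReal.rpow_mul]
  norm_num

theorem ae_memLp_slice {α : Type*} [MeasurableSpace α] {μ : Measure α} [SFinite μ]
    {β : Type*} [MeasurableSpace β] {ν : Measure β} [SFinite ν]
    {W : α × β → ℂ} (hW : Measurable W) (hLp : MemLp W 2 (μ.prod ν)) :
    ∀ᵐ t ∂μ, MemLp (fun x => W (t, x)) 2 ν := by
  have hm : Measurable fun t => ∫⁻ x, ‖W (t, x)‖ₑ ^ 2 ∂ν :=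
    (hW.enorm.pow_const 2).lintegral_prod_right'
  have h1 : ∫⁻ t, ∫⁻ x, ‖W (t, x)‖ₑ ^ 2 ∂ν ∂μ ≠ ∞ := by
    rw [← lintegral_prod _ (hW.enorm.pow_const 2).aemeasurable, ← eLpNorm_two_sq]
    exact ENNReal.pow_ne_top hLp.2.ne
  filter_upwards [ae_lt_top hm h1] with t ht
  refine ⟨(hW.comp measurable_prodMk_left).aestronglyMeasurable, ?_⟩
  rw [← eLpNorm_two_sq] at ht
  by_contra h
  rw [not_lt, top_le_iff] at h
  simp [h] at ht

end Extension

/-! ### Uniqueness, existence and extremal data -/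

section Conclusion

open Real Set Filter Topology

variable {n : ℕ}

/-- The evolution depends only on the initial datum, up to a null set of space-time. -/
theorem IsSmoothedEvolution.ae_eq {m : ℝ}
    {φ : Lp ℂ 2 (volume : Measure (EuclideanSpace ℝ (Fin n)))}
    {U V : ℝ × EuclideanSpace ℝ (Fin n) → ℂ} (hU : IsSmoothedEvolution m φ U)
    (hV : IsSmoothedEvolution m φ V) : U =ᵐ[volume] V := by
  obtain ⟨U', hU'm, hU'⟩ := hU.aestronglyMeasurable
  obtain ⟨V', hV'm, hV'⟩ := hV.aestronglyMeasurable
  have h1 : ∀ᵐ t : ℝ, ∀ᵐ x : EuclideanSpace ℝ (Fin n), U (t, x) = U' (t, x) :=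
    Measure.ae_ae_of_ae_prod hU'
  have h2 : ∀ᵐ t : ℝ, ∀ᵐ x : EuclideanSpace ℝ (Fin n), V (t, x) = V' (t, x) :=
    Measure.ae_ae_of_ae_prod hV'
  have h3 : ∀ᵐ p : ℝ × EuclideanSpace ℝ (Fin n), U' p = V' p := by
    rw [Measure.volume_eq_prod, Measure.ae_prod_iff_ae_ae
      (measurableSet_eq_fun hU'm.measurable hV'm.measurable)]
    filter_upwards [h1, h2, hU.isImage, hV.isImage] with t h1 h2 h4 h5
    have h6 := ae_eq_of_integral_mul_fourier_eq (fun ψ => (h4 ψ).1) (fun ψ => (h5 ψ).1)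
      fun ψ => (h4 ψ).2.2.trans (h5 ψ).2.2.symm
    filter_upwards [h1, h2, h6] with x h1 h2 h6
    rw [← h1, ← h2, h6]
  filter_upwards [hU', hV', h3] with p h1 h2 h3
  rw [h1, h2, h3]

/-- Extension of the evolution and of its bound from annular data to all of `L²`. -/
theorem exists_isSmoothedEvolution_le (hn : 3 ≤ n) {m : ℝ} (hm : 0 < m)
    (φ : Lp ℂ 2 (volume : Measure (EuclideanSpace ℝ (Fin n)))) :
    ∃ U, IsSmoothedEvolution m φ U ∧ weightedSpaceTimeNorm U ≤
      ENNReal.ofReal (√(2 * π / (m * ((n : ℝ) - 2)))) * ‖φ‖ₑ := by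
  have : Nonempty (Fin n) := ⟨⟨0, by omega⟩⟩
  set c := ENNReal.ofReal (√(2 * π / (m * ((n : ℝ) - 2)))) with hc
  have hctop : c ≠ ∞ := ENNReal.ofReal_ne_top
  let Φ : Lp ℂ 2 (volume : Measure (EuclideanSpace ℝ (Fin n))) := 𝓕 φ
  let f : EuclideanSpace ℝ (Fin n) → ℂ := Φ
  have hfm : Measurable f := (Lp.stronglyMeasurable Φ).measurable
  have hf : MemLp f 2 := Lp.memLp Φ
  have hfφ : eLpNorm f 2 volume = ‖φ‖ₑ := by
    rw [← Lp.enorm_def, ← ofReal_norm, ← ofReal_norm, Lp.norm_fourier_eq]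
  let δ : ℕ → ℝ≥0∞ := fun k => 2⁻¹ ^ k
  have hδ0 : ∀ k, 0 < δ k := fun k => ENNReal.pow_pos (by simp) k
  have hδanti : ∀ {i j}, i ≤ j → δ j ≤ δ i := fun h =>
    pow_le_pow_right_of_le_one' (by simp) h
  have hδsum : ∑' k, δ k = 2 := by rw [ENNReal.tsum_geometric, ENNReal.one_sub_inv_two, inv_inv]
  have hδlim : Tendsto δ atTop (𝓝 0) :=
    ENNReal.tendsto_atTop_zero_of_tsum_ne_top (by rw [hδsum]; simp)
  choose g hg hgf using fun k => exists_isAnnular_eLpNorm_sub_le (by omega) hfm hf (hδ0 k)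
  -- `W h` is the weighted evolution of the datum with Fourier transform `h`
  let W : (EuclideanSpace ℝ (Fin n) → ℂ) → ℝ × EuclideanSpace ℝ (Fin n) → ℂ :=
    fun h p => ((‖p.2‖⁻¹ : ℝ) : ℂ) * annularEvolution m h p
  have hWm : ∀ {h}, IsAnnular h → Measurable (W h) := fun hh =>
    Measurable.mul (by fun_prop) (measurable_annularEvolution m hh)
  have hWle : ∀ {h}, IsAnnular h → eLpNorm (W h) 2 volume ≤ c * eLpNorm h 2 volume := fun hh =>
    weightedSpaceTimeNorm_annularEvolution_le hn hm hh
  have hWLp : ∀ {h}, IsAnnular h → MemLp (W h) 2 volume := fun hh =>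
    ⟨(hWm hh).aestronglyMeasurable, (hWle hh).trans_lt
      (ENNReal.mul_lt_top hctop.lt_top (hh.memLp 2).2)⟩
  -- the term `δ N` is added only to make the inequality strict
  have hcauchy : ∀ N i j, N ≤ i → N ≤ j →
      eLpNorm (W (g i) - W (g j)) 2 volume < c * (2 * δ N) + δ N := by
    intro N i j hi hj
    have h1 : W (g i) - W (g j) = W (g i - g j) := by
      ext p
      simp only [W, Pi.sub_apply, annularEvolution_sub m (hg i) (hg j), mul_sub]
    have h2 : eLpNorm (g i - g j) 2 volume ≤ 2 * δ N := by
      rw [show g i - g j = (g i - f) - (g j - f) by abel, two_mul]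
      refine (eLpNorm_sub_le ((hg i).memLp 2 |>.sub hf).1 ((hg j).memLp 2 |>.sub hf).1
        (by norm_num)).trans ?_
      exact add_le_add ((hgf i).trans (hδanti hi)) ((hgf j).trans (hδanti hj))
    have hfin : c * (2 * δ N) ≠ ∞ := ENNReal.mul_ne_top hctop
      (ENNReal.mul_ne_top (by simp) (ENNReal.pow_ne_top (by simp)))
    rw [h1]
    refine ((hWle ((hg i).sub (hg j))).trans (mul_le_mul_right h2 c)).trans_lt ?_
    exact ENNReal.lt_add_right hfin (hδ0 N).ne'
  obtain ⟨V₀, hV₀, hlim₀⟩ := Lp.cauchy_complete_eLpNorm (p := 2) (by norm_num)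
    (fun k => hWLp (hg k)) (B := fun N => c * (2 * δ N) + δ N) (by
      rw [ENNReal.tsum_add, ENNReal.tsum_mul_left, ENNReal.tsum_mul_left, hδsum]
      exact ENNReal.add_ne_top.2 ⟨ENNReal.mul_ne_top hctop (by norm_num), by simp⟩) hcauchy
  obtain ⟨V, hVs, hVV₀⟩ := hV₀.1
  have hVm : Measurable V := hVs.measurable
  have hV : MemLp V 2 volume := hV₀.ae_eq hVV₀
  have hlim : Tendsto (fun k => eLpNorm (W (g k) - V) 2 volume) atTop (𝓝 0) := by
    refine hlim₀.congr fun k => eLpNorm_congr_ae ?_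
    exact EventuallyEq.rfl.sub hVV₀
  -- along a subsequence the convergence holds in `L²(ℝⁿ)` for almost every time
  obtain ⟨s, hs, hsV⟩ := extraction_forall_of_eventually
    (P := fun j k => eLpNorm (W (g k) - V) 2 volume ≤ δ j)
    fun j => hlim.eventually (ge_mem_nhds (hδ0 j))
  have hslice : ∀ᵐ t : ℝ, Tendsto (fun j => eLpNorm (fun x => (W (g (s j)) - V) (t, x)) 2 volume)
      atTop (𝓝 0) := by
    refine ae_tendsto_eLpNorm_slice (W := fun j => W (g (s j)) - V)
      (fun j => (hWm (hg _)).sub hVm) ?_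
    refine ne_top_of_le_ne_top (b := 2) (by simp) ?_
    refine le_of_le_of_eq (b := ∑' k, δ k) (ENNReal.tsum_le_tsum fun j => ?_) hδsum
    calc eLpNorm (W (g (s j)) - V) 2 volume ^ 2 ≤ δ j ^ 2 := by gcongr; exact hsV j
      _ = δ j * δ j := sq _
      _ ≤ δ j := mul_le_of_le_one_right' (pow_le_one' (by simp) j)
  have hWslice : ∀ᵐ t : ℝ, ∀ j, MemLp (fun x => W (g (s j)) (t, x)) 2 volume :=
    ae_all_iff.2 fun j => ae_memLp_slice (hWm (hg _)) (hWLp (hg _))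
  have hVslice : ∀ᵐ t : ℝ, MemLp (fun x => V (t, x)) 2 volume := ae_memLp_slice hVm hV
  have h0 : ∀ᵐ x : EuclideanSpace ℝ (Fin n), x ≠ 0 := by simp [ae_iff]
  refine ⟨fun p => ((‖p.2‖ : ℝ) : ℂ) * V p, ⟨Measurable.aestronglyMeasurable (by fun_prop), ?_⟩, ?_⟩
  · filter_upwards [hslice, hWslice, hVslice] with t ht hWt hVt
    intro ψ
    have hh : MemLp (fun x => ((‖x‖ : ℝ) : ℂ) * (𝓕 ψ) x) 2 volume := by
      have := memLp_norm_rpow_mul_schwartz (n := n) (by omega) (s := 1)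
        (by have : (3 : ℝ) ≤ n := by exact_mod_cast hn
            linarith) (𝓕 ψ)
      simpa using this
    have hσ := memLp_smoothingSymbol_mul_schwartz hn hm t ψ
    have e1 : ∀ x, ((‖x‖ : ℝ) : ℂ) * V (t, x) * (𝓕 ψ) x =
        V (t, x) * (((‖x‖ : ℝ) : ℂ) * (𝓕 ψ) x) := fun x => by ring
    have e2 : ∀ ξ, smoothingSymbol m t ((2 * π) • ξ) * Φ ξ * ψ ξ =
        f ξ * (smoothingSymbol m t ((2 * π) • ξ) * ψ ξ) := fun ξ => by
      simp only [f]; ring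
    have e3 : ∀ j, ∫ x, W (g (s j)) (t, x) * (((‖x‖ : ℝ) : ℂ) * (𝓕 ψ) x) =
        ∫ ξ, g (s j) ξ * (smoothingSymbol m t ((2 * π) • ξ) * ψ ξ) := by
      intro j
      let χ : Lp ℂ 2 (volume : Measure (EuclideanSpace ℝ (Fin n))) :=
        𝓕⁻ (((hg (s j)).memLp 2).toLp (g (s j)))
      have hχ : (𝓕 χ : Lp ℂ 2 (volume : Measure (EuclideanSpace ℝ (Fin n)))) =ᵐ[volume] g (s j) := by
        simp only [χ, FourierTransform.fourier_fourierInv_eq]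
        exact MemLp.coeFn_toLp _
      have h1 := (isFourierMultiplierImage_annularEvolution m t (hg (s j)) hχ ψ).2.2
      calc _ = ∫ x, annularEvolution m (g (s j)) (t, x) * (𝓕 ψ) x := by
            refine integral_congr_ae ?_
            filter_upwards [h0] with x hx
            have : ((‖x‖ : ℝ) : ℂ) ≠ 0 := by simpa using hx
            simp only [W]
            push_cast
            field_simp
        _ = _ := h1
        _ = _ := by
            refine integral_congr_ae ?_
            filter_upwards [hχ] with ξ hξ
            rw [hξ]
            ring
    refine ⟨?_, ?_, ?_⟩
    · simp_rw [e1]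
      exact hVt.integrable_mul hh
    · change Integrable (fun ξ => smoothingSymbol m t ((2 * π) • ξ) * Φ ξ * ψ ξ) volume
      simp_rw [e2]
      exact hf.integrable_mul hσ
    · change _ = ∫ ξ, smoothingSymbol m t ((2 * π) • ξ) * Φ ξ * ψ ξ
      simp_rw [e1, e2]
      have l1 := tendsto_integral_mul_of_tendsto_eLpNorm hWt hVt hh ht
      have l2 := tendsto_integral_mul_of_tendsto_eLpNorm (fun j => (hg (s j)).memLp 2) hf hσ
        (tendsto_of_tendsto_of_tendsto_of_le_of_le tendsto_const_nhds
          (hδlim.comp hs.tendsto_atTop) (fun _ => zero_le) fun j => hgf (s j))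
      simp_rw [e3] at l1
      exact tendsto_nhds_unique l1 l2
  · have h0' : ∀ᵐ p : ℝ × EuclideanSpace ℝ (Fin n), p.2 ≠ 0 :=
      Measure.quasiMeasurePreserving_snd.ae h0
    have h1 : weightedSpaceTimeNorm (fun p : ℝ × EuclideanSpace ℝ (Fin n) =>
        ((‖p.2‖ : ℝ) : ℂ) * V p) = eLpNorm V 2 volume := by
      refine eLpNorm_congr_ae ?_
      filter_upwards [h0'] with p hp
      have : ((‖p.2‖ : ℝ) : ℂ) ≠ 0 := by simpa using hp
      push_cast
      field_simp
    rw [h1, ← hfφ]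
    have h2 : Tendsto (fun k => c * (eLpNorm f 2 volume + δ k) + eLpNorm (W (g k) - V) 2 volume)
        atTop (𝓝 (c * (eLpNorm f 2 volume + 0) + 0)) :=
      (ENNReal.Tendsto.const_mul (tendsto_const_nhds.add hδlim) (Or.inr hctop)).add hlim
    rw [add_zero, add_zero] at h2
    refine ge_of_tendsto' h2 fun k => ?_
    calc eLpNorm V 2 volume = eLpNorm (W (g k) - (W (g k) - V)) 2 volume := by
          rw [sub_sub_cancel]
      _ ≤ eLpNorm (W (g k)) 2 volume + eLpNorm (W (g k) - V) 2 volume :=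
          eLpNorm_sub_le (hWLp (hg k)).1 ((hWLp (hg k)).sub hV).1 (by norm_num)
      _ ≤ _ := by
          refine add_le_add ((hWle (hg k)).trans (mul_le_mul_right ?_ c)) le_rfl
          calc eLpNorm (g k) 2 volume = eLpNorm (f + (g k - f)) 2 volume := by
                rw [add_sub_cancel]
            _ ≤ _ := (eLpNorm_add_le hf.1 (((hg k).memLp 2).sub hf).1 (by norm_num)).trans
                (add_le_add le_rfl (hgf k))

/-- The indicator function of an annulus is the Fourier transform of a nonzero extremal datum. -/
theorem exists_isSmoothedEvolution_extremal (hn : 3 ≤ n) {m : ℝ} (hm : 0 < m) :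
    ∃ (φ : Lp ℂ 2 (volume : Measure (EuclideanSpace ℝ (Fin n)))) (U : _),
      IsSmoothedEvolution m φ U ∧ 0 < ‖φ‖ ∧ weightedSpaceTimeNorm U =
        ENNReal.ofReal (√(2 * π / (m * ((n : ℝ) - 2))) * ‖φ‖) := by
  have : Nonempty (Fin n) := ⟨⟨0, by omega⟩⟩
  let f₀ : ℝ → ℂ := (Icc (1 : ℝ) 2).indicator 1
  let f : EuclideanSpace ℝ (Fin n) → ℂ := fun ξ => f₀ ‖ξ‖
  have hf₀ : ∀ r, f₀ r ≠ 0 → r ∈ Icc (1 : ℝ) 2 := fun r hr => mem_of_indicator_ne_zero hr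
  have hf : IsAnnular f := by
    refine ⟨(measurable_one.indicator measurableSet_Icc).comp measurable_norm,
      ⟨1, fun ξ => ?_⟩, ⟨1, 2, one_pos, fun ξ hξ => hf₀ _ hξ⟩⟩
    by_cases h : ‖ξ‖ ∈ Icc (1 : ℝ) 2
    · simp only [f, f₀, indicator_of_mem h]; simp
    · simp only [f, f₀, indicator_of_notMem h]; simp
  let φ : Lp ℂ 2 (volume : Measure (EuclideanSpace ℝ (Fin n))) := 𝓕⁻ ((hf.memLp 2).toLp f)
  have h𝓕 : (𝓕 φ : Lp ℂ 2 (volume : Measure (EuclideanSpace ℝ (Fin n)))) = (hf.memLp 2).toLp f :=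
    FourierTransform.fourier_fourierInv_eq _
  have hφ : (𝓕 φ : Lp ℂ 2 (volume : Measure (EuclideanSpace ℝ (Fin n)))) =ᵐ[volume] f := by
    rw [h𝓕]
    exact MemLp.coeFn_toLp _
  have hnorm : eLpNorm f 2 volume = ENNReal.ofReal ‖φ‖ := by
    rw [← Lp.norm_fourier_eq, h𝓕, ofReal_norm, Lp.enorm_toLp]
  refine ⟨φ, annularEvolution m f, isSmoothedEvolution_annularEvolution m hf hφ, ?_, ?_⟩
  · rw [norm_pos_iff]
    intro h
    rw [h, norm_zero, ENNReal.ofReal_zero, eLpNorm_eq_zero_iff (hf.memLp 2).1 two_ne_zero] at hnorm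
    -- the open annulus is nonempty, so it has positive measure
    have hball : volume {ξ : EuclideanSpace ℝ (Fin n) | 1 < ‖ξ‖ ∧ ‖ξ‖ < 2} = 0 := by
      refine measure_mono_null (fun ξ hξ => ?_) hnorm
      have : ‖ξ‖ ∈ Icc (1 : ℝ) 2 := ⟨hξ.1.le, hξ.2.le⟩
      simpa [f, f₀] using this
    have hopen : IsOpen {ξ : EuclideanSpace ℝ (Fin n) | 1 < ‖ξ‖ ∧ ‖ξ‖ < 2} :=
      (isOpen_lt continuous_const continuous_norm).inter (isOpen_lt continuous_norm continuous_const)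
    rw [hopen.measure_eq_zero_iff volume] at hball
    obtain ⟨ξ, hξ⟩ : ∃ ξ : EuclideanSpace ℝ (Fin n), ‖ξ‖ = 3 / 2 :=
      ⟨EuclideanSpace.single ⟨0, by omega⟩ (3 / 2), by simp⟩
    have : ξ ∈ {ξ : EuclideanSpace ℝ (Fin n) | 1 < ‖ξ‖ ∧ ‖ξ‖ < 2} := by
      constructor <;> rw [hξ] <;> norm_num
    rw [hball] at this
    exact this
  · rw [weightedSpaceTimeNorm_annularEvolution_radial hn hm hf (f₀ := f₀) (fun _ => rfl), hnorm,
      ENNReal.ofReal_mul (sqrt_nonneg _)]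

end Conclusion

theorem mainTheorem10 (n : ℕ) (hn : 3 ≤ n) (m : ℝ) (hm : 0 < m) :
    (∀ φ : Lp ℂ 2 (volume : Measure (EuclideanSpace ℝ (Fin n))),
      ∃ U, IsSmoothedEvolution m φ U) ∧
    (∀ (φ : Lp ℂ 2 (volume : Measure (EuclideanSpace ℝ (Fin n))))
      (U : ℝ × EuclideanSpace ℝ (Fin n) → ℂ), IsSmoothedEvolution m φ U →
        weightedSpaceTimeNorm U ≤
          ENNReal.ofReal (Real.sqrt (2 * Real.pi / (m * ((n : ℝ) - 2))) * ‖φ‖)) ∧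
    (∀ C : ℝ, C < Real.sqrt (2 * Real.pi / (m * ((n : ℝ) - 2))) →
      ∃ (φ : Lp ℂ 2 (volume : Measure (EuclideanSpace ℝ (Fin n))))
        (U : ℝ × EuclideanSpace ℝ (Fin n) → ℂ), IsSmoothedEvolution m φ U ∧
          ENNReal.ofReal (C * ‖φ‖) < weightedSpaceTimeNorm U) := by
  refine ⟨fun φ => ?_, fun φ U hU => ?_, fun C hC => ?_⟩
  · obtain ⟨U, hU, -⟩ := exists_isSmoothedEvolution_le hn hm φ
    exact ⟨U, hU⟩
  · obtain ⟨V, hV, hle⟩ := exists_isSmoothedEvolution_le hn hm φ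
    have h : weightedSpaceTimeNorm U = weightedSpaceTimeNorm V := by
      refine eLpNorm_congr_ae ?_
      filter_upwards [hU.ae_eq hV] with p hp
      rw [hp]
    rwa [h, ENNReal.ofReal_mul (Real.sqrt_nonneg _), ofReal_norm]
  · obtain ⟨φ, U, hU, hpos, h⟩ := exists_isSmoothedEvolution_extremal hn hm
    refine ⟨φ, U, hU, ?_⟩
    have hn' : (3 : ℝ) ≤ n := by exact_mod_cast hn
    have hκ : 0 < 2 * Real.pi / (m * ((n : ℝ) - 2)) :=
      div_pos (by positivity) (mul_pos hm (by linarith))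
    rw [h]
    exact (ENNReal.ofReal_lt_ofReal_iff (mul_pos (Real.sqrt_pos.2 hκ) hpos)).2
      (mul_lt_mul_of_pos_right hC hpos)
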